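/- Let $\mathcal H$ be a finite-dimensional Hilbert space, with operators identified with complex matrices through an orthonormal basis, and write $\langle A|B\rangle=\operatorname{tr}(A^*B)$. A state is an operator $\rho\ge 0$ with $\operatorname{tr}\rho=1$; it is faithful if $\ker\rho=\{0\}$. A Lindbladian (with chosen representation) is a super-operator $$\mathcal L(\rho)=-i[H,\rho]+\sum_l\Big(\Gamma_l\rho\Gamma_l^*-\tfrac12\{\Gamma_l^*\Gamma_l,\rho\}\Big),$$ where $H=H^*$ and the sum is finite; its associated completely positive map is $\Phi(X)=\sum_l\Gamma_l^*X\Gamma_l$, and $\mathcal L^\dagger$ is its adjoint: $\langle\mathcal L(A)|B\rangle=\langle A|\mathcal L^\dagger(B)\rangle$. A steady state of $\mathcal L$ is a state in $\ker\mathcal L$. A pair $(\rho,\mathcal L)$, with $\rho$ a steady state of $\mathcal L$, satisfies detailed balance if $\rho$ is faithful and $\operatorname{tr}(\rho A^*\Phi(B))=\operatorname{tr}(\rho\,\Phi(A)^*B)$ for all $A,B$. Let $S(\rho)=-\langle\rho|\log\rho\rangle$ (with $0\log 0=0$), and let $\operatorname{Ent}(\mu|\nu)=\langle\mu|\log\mu-\log\nu\rangle$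 if $\ker\nu\subset\ker\mu$ and $+\infty$ otherwise. For a Lindbladian $\mathcal K$, a self-adjoint observable $S=\sum_{s\in\operatorname{spec}(S)}sP_s$, a state $\rho_0$ and $t\ge0$, the two-time-measurement law of the variation $\Delta S$ is $$\mathbb Q(\Delta S=\sigma)=\sum_{s,s'\in\operatorname{spec}(S),\ s'-s=\sigma}\langle e^{t\mathcal K}(P_s\rho_0P_s)|P_{s'}\rangle .$$ Let $\mathcal L=\sum_{j\in J}\mathcal L_j$, with $J$ finite and $\mathcal L$ and all $\mathcal L_j$ Lindbladians, where each $\mathcal L_j$ has a unique faithful steady state $\rho_j^+$. Assume that $(\rho_j^+,\mathcal L_j)$ satisfies detailed balance for every $j$. Put $S_j^+=-\log\rho_j^+$ and $\mathcal I_j^+=\mathcal L_j^\dagger(S_j^+)$, let $\mathbb E^t_{j,\rho_0}$ denote the expectation for the two-time-measurement law of $S_j^+$ under $e^{t\mathcal L_j}$ from $\rho_0$, and for a state $\rho$ let $$\mathrm{EP}_j(\rho)=-\frac{d}{dt}\operatorname{Ent}(e^{t\mathcal L_j}(\rho)|\rho_j^+)\Big|_{t=0^+},\qquad \mathrm{EP}(\rho)=\sum_{j\in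 J}\mathrm{EP}_j(\rho),$$ where $\mathrm{EP}_j$ may take infinite values. Then, for every $j\in J$, every state $\rho_0$ and every $t\ge0$, the derivative defining $\mathrm{EP}_j(e^{s\mathcal L_j}(\rho_0))$ exists and is finite for almost every $s\in[0,t]$, the function $s\mapsto\mathrm{EP}_j(e^{s\mathcal L_j}(\rho_0))$ is integrable on $[0,t]$, and $$\mathbb E^t_{j,\rho_0}(\Delta S_j^+)=\int_0^t\langle e^{s\mathcal L_j}(\rho_0)|\mathcal I_j^+\rangle\,ds=S(e^{t\mathcal L_j}(\rho_0))-S(\rho_0)-\int_0^t\mathrm{EP}_j(e^{s\mathcal L_j}(\rho_0))\,ds .$$ In particular, for every steady state $\rho^+$ of $\mathcal L$, the derivatives defining $\mathrm{EP}_j(\rho^+)$ exist and are finite, and $$\mathrm{EP}(\rho^+)=-\lim_{t\downarrow0}\sum_{j\in J}\mathbb E^t_{j,\rho^+}\!\left(\frac{\Delta S_j^+}{t}\right).$$ -/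

import Mathlib

open Matrix Filter Topology MeasureTheory
open scoped ComplexOrder

namespace MQD

variable {n : Type*} [Fintype n] [DecidableEq n]

/-- The duality bracket `⟨A | B⟩ = tr (A⋆ B)`. -/
def bracket (A B : Matrix n n ℂ) : ℂ := (Aᴴ * B).trace

/-- States, i.e. density matrices: positive semidefinite matrices of unit trace. A state `ρ` is
faithful when `ρ.PosDef`. -/
def IsState (ρ : Matrix n n ℂ) : Prop := ρ.PosSemidef ∧ ρ.trace = 1

/-- The adjoint `M†` of a super-operator with respect to the duality bracket; its `(i, j)` entry at
`B` is `⟨M (E_ij) | B⟩`, where `E_ij` are the matrix units (see `bracket_dual`). -/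
def dual (M : Matrix n n ℂ →ₗ[ℂ] Matrix n n ℂ) : Matrix n n ℂ →ₗ[ℂ] Matrix n n ℂ where
  toFun B := Matrix.of fun i j => bracket (M (Matrix.single i j 1)) B
  map_add' A B := by ext i j; simp [bracket, mul_add]
  map_smul' c B := by ext i j; simp [bracket]

/-- The defining property of the adjoint: `⟨M A | B⟩ = ⟨A | M† B⟩`. -/
theorem bracket_dual (M : Matrix n n ℂ →ₗ[ℂ] Matrix n n ℂ) (A B : Matrix n n ℂ) :
    bracket (M A) B = bracket A (dual M B) := by
  have hA : A = ∑ i, ∑ j, A i j • Matrix.single i j (1 : ℂ) := by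
    simpa using Matrix.matrix_eq_sum_single A
  have h1 : M A = ∑ i, ∑ j, A i j • M (Matrix.single i j 1) := by
    conv_lhs => rw [hA]
    simp only [map_sum, map_smul]
  have h2 : bracket A (dual M B) = ∑ i, ∑ j, star (A i j) * bracket (M (Matrix.single i j 1)) B := by
    rw [Finset.sum_comm]
    simp [bracket, Matrix.trace, Matrix.mul_apply, dual]
  rw [h2, h1]
  simp [bracket, Matrix.conjTranspose_sum, Matrix.sum_mul, Matrix.trace_sum]

/-- A Lindbladian together with a chosen representation: a self-adjoint Hamiltonian `H` and
finitely many operators `Γ l`. -/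
structure Lindbladian (n : Type*) [Fintype n] [DecidableEq n] where
  H : Matrix n n ℂ
  isHermitian : H.IsHermitian
  numΓ : ℕ
  Γ : Fin numΓ → Matrix n n ℂ

/-- The super-operator
`ρ ↦ -i [H, ρ] + ∑ l, (Γ_l ρ Γ_l⋆ - (1/2) {Γ_l⋆ Γ_l, ρ})`. -/
noncomputable def Lindbladian.gen (L : Lindbladian n) : Matrix n n ℂ →ₗ[ℂ] Matrix n n ℂ where
  toFun ρ := -Complex.I • (L.H * ρ - ρ * L.H) +
    ∑ l, (L.Γ l * ρ * (L.Γ l)ᴴ -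
      (1 / 2 : ℂ) • ((L.Γ l)ᴴ * L.Γ l * ρ + ρ * ((L.Γ l)ᴴ * L.Γ l)))
  map_add' A B := by
    rw [add_add_add_comm, ← smul_add, ← Finset.sum_add_distrib]
    congr 1
    · congr 1; noncomm_ring
    · refine Finset.sum_congr rfl fun l _ => ?_
      rw [sub_add_sub_comm, ← smul_add]
      congr 1
      · noncomm_ring
      · congr 1; noncomm_ring
  map_smul' c A := by
    simp only [RingHom.id_apply, smul_add, Finset.smul_sum, smul_sub, Matrix.mul_smul,
      Matrix.smul_mul, smul_comm c]

/-- The completely positive map `Φ(X) = ∑ l, Γ_l⋆ X Γ_l` associated to a Lindbladian. -/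
def Lindbladian.cpMap (L : Lindbladian n) (X : Matrix n n ℂ) : Matrix n n ℂ :=
  ∑ l, (L.Γ l)ᴴ * X * L.Γ l

/-- Steady states: states in the kernel of the Lindbladian. -/
def Lindbladian.IsSteadyState (L : Lindbladian n) (ρ : Matrix n n ℂ) : Prop :=
  IsState ρ ∧ L.gen ρ = 0

/-- The exponential series of a linear map on a finite-dimensional space converges. -/
theorem summable_exp_series {E : Type*} [NormedAddCommGroup E] [NormedSpace ℂ E]
    [FiniteDimensional ℂ E] (T : E →ₗ[ℂ] E) (c : ℂ) (x : E) :
    Summable fun k : ℕ => ((k.factorial : ℂ)⁻¹ * c ^ k) • (T ^ k) x := by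
  have : CompleteSpace E := FiniteDimensional.complete ℂ E
  have h := (NormedSpace.expSeries_summable' (𝕂 := ℂ) (c • LinearMap.toContinuousLinearMap T)).map
    (ContinuousLinearMap.apply ℂ E x) (ContinuousLinearMap.apply ℂ E x).continuous
  convert h using 2 with k
  have : ∀ (k : ℕ) (y : E), ((LinearMap.toContinuousLinearMap T) ^ k) y = (T ^ k) y := by
    intro k
    induction k with
    | zero => intro y; rfl
    | succ k ih => intro y; rw [pow_succ, pow_succ]; exact ih (T y)
  simp [smul_pow, this, mul_smul]

/-- The Markov quantum dynamics `e^{tL} ρ = ∑_k (t^k / k!) L^k ρ`, a series that always converges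
(see `Lindbladian.summable_evol`). -/
noncomputable def Lindbladian.evol (L : Lindbladian n) (t : ℝ) (ρ : Matrix n n ℂ) :
    Matrix n n ℂ :=
  ∑' k : ℕ, ((k.factorial : ℂ)⁻¹ * (t : ℂ) ^ k) • (L.gen ^ k) ρ

open scoped Matrix.Norms.Elementwise in
theorem Lindbladian.summable_evol (L : Lindbladian n) (t : ℝ) (ρ : Matrix n n ℂ) :
    Summable fun k : ℕ => ((k.factorial : ℂ)⁻¹ * (t : ℂ) ^ k) • (L.gen ^ k) ρ :=
  summable_exp_series L.gen t ρ

/-- The multi-reservoir structure: `L = ∑ j, L_j`, and each `L_j` has a unique faithful steady state,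
namely `ρ_j`. -/
def ReservoirStructure {J : Type*} [Fintype J] (L : Lindbladian n) (Ls : J → Lindbladian n)
    (ρs : J → Matrix n n ℂ) : Prop :=
  L.gen = ∑ j, (Ls j).gen ∧
    ∀ j, ((Ls j).IsSteadyState (ρs j) ∧ (ρs j).PosDef) ∧
      ∀ σ, (Ls j).IsSteadyState σ → σ.PosDef → σ = ρs j

/-- The inner product `⟨A | B⟩_ρ = tr (ρ A⋆ B)`. -/
def weightedInner (ρ A B : Matrix n n ℂ) : ℂ := (ρ * Aᴴ * B).trace

/-- Detailed balance for a pair `(ρ, L)`, with `ρ` a steady state of `L`: `ρ` is faithful and the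
completely positive map associated to `L` is self-adjoint for `⟨· | ·⟩_ρ`. -/
def DetailedBalance (ρ : Matrix n n ℂ) (L : Lindbladian n) : Prop :=
  L.IsSteadyState ρ ∧ ρ.PosDef ∧
    ∀ A B, weightedInner ρ A (L.cpMap B) = weightedInner ρ (L.cpMap A) B

/-- Logarithm of a positive semidefinite matrix by functional calculus, with `log 0 = 0`; the value
of the logarithm at `0` is irrelevant wherever it is used below, due to `0 log 0 = 0`. -/
noncomputable def matLog (ρ : Matrix n n ℂ) : Matrix n n ℂ := cfc Real.log ρ

/-- The von Neumann entropy `S(ρ) = -⟨ρ | log ρ⟩`. -/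
noncomputable def vonNeumannEntropy (ρ : Matrix n n ℂ) : ℝ := -(bracket ρ (matLog ρ)).re

open scoped Classical in
/-- The relative entropy `Ent(μ | ν)`, equal to `⟨μ | log μ - log ν⟩` if `ker ν ⊆ ker μ` and to
`+∞` otherwise. -/
noncomputable def relEntropy (μ ν : Matrix n n ℂ) : EReal :=
  if ∀ v : n → ℂ, ν *ᵥ v = 0 → μ *ᵥ v = 0 then
    (((bracket μ (matLog μ - matLog ν)).re : ℝ) : EReal)
  else ⊤

/-- The difference quotient `-(Ent(e^{tL} ρ | ν) - Ent(ρ | ν)) / t`. -/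
noncomputable def epQuotient (L : Lindbladian n) (ν ρ : Matrix n n ℂ) (t : ℝ) : EReal :=
  (relEntropy ρ ν - relEntropy (L.evol t ρ) ν) / (t : EReal)

/-- The entropy production of a single reservoir: minus the (right) derivative at `t = 0` of
`Ent(e^{tL} ρ | ν)`, which may be infinite. -/
noncomputable def entropyProduction (L : Lindbladian n) (ν ρ : Matrix n n ℂ) : EReal :=
  limUnder (𝓝[>] (0 : ℝ)) (epQuotient L ν ρ)

/-- The total (Lebowitz-Spohn) entropy production. -/
noncomputable def totalEntropyProduction {J : Type*} [Fintype J] (Ls : J → Lindbladian n)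
    (ρs : J → Matrix n n ℂ) (ρ : Matrix n n ℂ) : EReal :=
  ∑ j, entropyProduction (Ls j) (ρs j) ρ

/-- The spectrum of an observable, as a finite set of reals. -/
noncomputable def spec (S : Matrix n n ℂ) : Finset ℝ :=
  (Matrix.finite_real_spectrum (A := S)).toFinset

/-- The spectral projection `P_s` of the observable `S`. -/
noncomputable def specProj (S : Matrix n n ℂ) (s : ℝ) : Matrix n n ℂ :=
  cfc (fun x : ℝ => if x = s then (1 : ℝ) else 0) S

/-- The law of the variation `ΔS` in the two-time measurement of `S` over `[0, t]`, for the dynamics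
`e^{tL}` and the initial state `ρ₀`:
`Q(ΔS = σ) = ∑_{s, s' ∈ spec S, s' - s = σ} ⟨e^{tL}(P_s ρ₀ P_s) | P_{s'}⟩`. -/
noncomputable def tmpLaw (L : Lindbladian n) (S ρ₀ : Matrix n n ℂ) (t σ : ℝ) : ℝ :=
  ∑ p ∈ (spec S ×ˢ spec S).filter (fun p => p.2 - p.1 = σ),
    (bracket (L.evol t (specProj S p.1 * ρ₀ * specProj S p.1)) (specProj S p.2)).re

/-- The expectation of `f (ΔS)` under the two-time measurement law. -/
noncomputable def tmpExpectation (L : Lindbladian n) (S ρ₀ : Matrix n n ℂ) (t : ℝ)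
    (f : ℝ → ℝ) : ℝ :=
  ∑ σ ∈ (spec S ×ˢ spec S).image (fun p => p.2 - p.1), f σ * tmpLaw L S ρ₀ t σ

/-- The entropic observable `S⁺ = -log ρ⁺`. -/
noncomputable def entropyObs (ρ : Matrix n n ℂ) : Matrix n n ℂ := -matLog ρ

/-- The entropy flux observable `I⁺ = L†(S⁺)`. -/
noncomputable def fluxObs (L : Lindbladian n) (ρ : Matrix n n ℂ) : Matrix n n ℂ :=
  dual L.gen (entropyObs ρ)

end MQD

open MQD

namespace MQD

variable {n : Type*} [Fintype n] [DecidableEq n]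

/-! ### The generator and its adjoint -/

namespace Lindbladian

/-! The balance combines an exact formula for the measured mean with an absolute continuity
statement for the entropy.

Measurement. Detailed balance makes the commutant of `ρ_j` invariant under `L_j†` (`commute_cpMap`,
`commute_hamiltonian`). All iterates of `L_j†` on `S_j` thus commute with `S_j`, so the dephasing
caused by the first measurement is invisible to the mean of `S_j` at later times. The expectation is
then a plain difference of means (`tmpExpectation_mul`), which is the integral of the flux.

Entropy. Since `ρ_j` is faithful, `Ent(μ | ρ_j) = -S(μ) + ⟨μ | S_j⟩`, so only `t ↦ S(e^{tL} ρ)`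
needs work. It may fail to be differentiable where eigenvalues vanish, so `-x log x` is replaced by
`-(x+ε) log (x+ε)`. In an eigenvector of `ρ` with eigenvalue `p`, the diagonal entry of `L ρ` is at
least `-C p`; hence, up to a correction linear in `ε`, the regularized rates increase as `ε`
decreases. Monotone convergence gives an integrable rate, and Lebesgue differentiation an almost
everywhere derivative.

Steady states. On `ker ρ⁺` the diagonal entries of the `L_j ρ⁺` are nonnegative and add up to zero,
so each vanishes. This removes the logarithmic divergence and gives a right derivative at time zero
for every `j`. The entropy terms `tr (L_j ρ⁺ log ρ⁺)` sum to zero, leaving minus the total flux. -/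

theorem trace_gen (L : Lindbladian n) (ρ : Matrix n n ℂ) : (L.gen ρ).trace = 0 := by
  simp only [gen, LinearMap.coe_mk, AddHom.coe_mk, trace_add, trace_smul, trace_sub, trace_sum]
  rw [trace_mul_comm L.H ρ, sub_self, smul_zero, zero_add]
  refine Finset.sum_eq_zero fun l _ => ?_
  rw [trace_mul_cycle (L.Γ l) ρ, trace_mul_comm ρ ((L.Γ l)ᴴ * L.Γ l)]
  simp only [smul_eq_mul]
  ring

/-- The non-Hermitian effective Hamiltonian part `K = -iH - (1/2) ∑ l, Γ_l⋆ Γ_l`. -/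
noncomputable def drift (L : Lindbladian n) : Matrix n n ℂ :=
  -Complex.I • L.H - (1 / 2 : ℂ) • ∑ l, (L.Γ l)ᴴ * L.Γ l

theorem gen_eq_drift (L : Lindbladian n) (ρ : Matrix n n ℂ) :
    L.gen ρ = L.drift * ρ + ρ * L.driftᴴ + ∑ l, L.Γ l * ρ * (L.Γ l)ᴴ := by
  have hH : L.Hᴴ = L.H := L.isHermitian
  simp only [gen, drift, LinearMap.coe_mk, AddHom.coe_mk, conjTranspose_sub, conjTranspose_smul,
    conjTranspose_sum, conjTranspose_mul, conjTranspose_conjTranspose, hH, Finset.sum_sub_distrib,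
    sub_mul, mul_sub, Matrix.sum_mul, Matrix.mul_sum, Finset.sum_add_distrib, smul_add,
    Matrix.smul_mul, Matrix.mul_smul, ← Finset.smul_sum, smul_sub]
  simp
  abel

theorem conjTranspose_gen (L : Lindbladian n) (ρ : Matrix n n ℂ) : (L.gen ρ)ᴴ = L.gen ρᴴ := by
  simp only [gen_eq_drift, conjTranspose_add, conjTranspose_mul, conjTranspose_sum,
    conjTranspose_conjTranspose, mul_assoc]
  abel

theorem dual_gen (L : Lindbladian n) (X : Matrix n n ℂ) :
    dual L.gen X = Complex.I • (L.H * X - X * L.H) + L.cpMap X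
      - (1 / 2 : ℂ) • (L.cpMap 1 * X + X * L.cpMap 1) := by
  have hH : L.Hᴴ = L.H := L.isHermitian
  have key : ∀ A, (Aᴴ * dual L.gen X).trace = (Aᴴ * (Complex.I • (L.H * X - X * L.H) + L.cpMap X
      - (1 / 2 : ℂ) • (L.cpMap 1 * X + X * L.cpMap 1))).trace := by
    intro A
    have h := bracket_dual L.gen A X
    simp only [bracket] at h
    rw [← h]
    have h1 : ∀ l, ((L.Γ l) * (Aᴴ * ((L.Γ l)ᴴ * X))).trace
        = (Aᴴ * ((L.Γ l)ᴴ * (X * L.Γ l))).trace := fun l => by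
      rw [trace_mul_comm]; simp only [mul_assoc]
    have h2 : ∀ l, ((L.Γ l)ᴴ * (L.Γ l * (Aᴴ * X))).trace
        = (Aᴴ * (X * ((L.Γ l)ᴴ * L.Γ l))).trace := fun l => by
      rw [← mul_assoc, trace_mul_comm]; simp only [mul_assoc]
    have h3 : (L.H * (Aᴴ * X)).trace = (Aᴴ * (X * L.H)).trace := by
      rw [trace_mul_comm]; simp only [mul_assoc]
    simp only [gen, LinearMap.coe_mk, AddHom.coe_mk, conjTranspose_add, conjTranspose_sub,
      conjTranspose_smul, conjTranspose_sum, conjTranspose_mul, conjTranspose_conjTranspose, hH,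
      cpMap, add_mul, sub_mul, mul_add, mul_sub, Matrix.smul_mul, Matrix.mul_smul, Matrix.sum_mul,
      Matrix.mul_sum, trace_add, trace_sub, trace_smul, trace_sum, mul_assoc, mul_one, h1, h2, h3,
      smul_add, smul_sub, Finset.sum_add_distrib, Finset.sum_sub_distrib, ← Finset.smul_sum]
    simp
    ring
  refine Matrix.ext_iff_trace_mul_left.mpr fun A => ?_
  simpa using key Aᴴ

end Lindbladian

theorem bracket_pow_dual (M : Matrix n n ℂ →ₗ[ℂ] Matrix n n ℂ) (k : ℕ) (A B : Matrix n n ℂ) :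
    bracket ((M ^ k) A) B = bracket A ((dual M ^ k) B) := by
  induction k generalizing A B with
  | zero => rfl
  | succ k ih =>
    rw [pow_succ, pow_succ']
    exact (ih (M A) B).trans (bracket_dual M A _)

theorem trace_mul_cpMap (L : Lindbladian n) (ρ B : Matrix n n ℂ) :
    (ρ * L.cpMap B).trace = ((∑ l, L.Γ l * ρ * (L.Γ l)ᴴ) * B).trace := by
  simp only [Lindbladian.cpMap, Matrix.mul_sum, Matrix.sum_mul, trace_sum]
  refine Finset.sum_congr rfl fun l _ => ?_
  rw [← mul_assoc, trace_mul_comm]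
  simp only [mul_assoc]

theorem conjTranspose_cpMap (L : Lindbladian n) (B : Matrix n n ℂ) :
    (L.cpMap B)ᴴ = L.cpMap Bᴴ := by
  simp [Lindbladian.cpMap, conjTranspose_sum, mul_assoc]

/-! ### Invariance of the commutant under detailed balance -/

namespace DetailedBalance

variable {ρ : Matrix n n ℂ} {L : Lindbladian n}

/-- The symmetry of `Φ` is used for the pairs `(A⋆, B)` and `(B⋆, A)`; cyclicity of the trace and
`ρB = Bρ` link the two identities, for an arbitrary test matrix `A`. -/
theorem commute_cpMap (h : DetailedBalance ρ L) {B : Matrix n n ℂ} (hB : Commute ρ B) :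
    Commute ρ (L.cpMap B) := by
  obtain ⟨-, -, h⟩ := h
  refine Matrix.ext_iff_trace_mul_left.mpr fun A => ?_
  have h1 := h Aᴴ B
  have h2 := h Bᴴ A
  simp only [weightedInner, conjTranspose_conjTranspose, conjTranspose_cpMap] at h1 h2
  have e1 : (A * (ρ * L.cpMap B)).trace = (ρ * L.cpMap B * A).trace := trace_mul_comm _ _
  have e2 : (A * (L.cpMap B * ρ)).trace = (ρ * A * L.cpMap B).trace := by
    rw [← mul_assoc, trace_mul_comm, mul_assoc]
  rw [e1, e2, h1, ← h2, hB.eq, mul_assoc, trace_mul_comm B]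

/-- Symmetry against the identity gives `∑ Γ ρ Γ⋆ = ρ Φ(1)`. As `ρ` commutes with `Φ(1)`, this
cancels the anticommutator term, and stationarity reduces to `[H, ρ] = 0`. -/
theorem commute_hamiltonian (h : DetailedBalance ρ L) : Commute ρ L.H := by
  have h1 := h.commute_cpMap (Commute.one_right ρ)
  have h2 : ∑ l, L.Γ l * ρ * (L.Γ l)ᴴ = ρ * L.cpMap 1 := by
    refine Matrix.ext_iff_trace_mul_right.mpr fun A => ?_
    have := h.2.2 1 A
    simp only [weightedInner, conjTranspose_one, mul_one, conjTranspose_cpMap] at this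
    rw [← this, trace_mul_cpMap]
  have h3 := h.1.2
  have h4 : L.gen ρ = -Complex.I • (L.H * ρ - ρ * L.H) := by
    have : ∑ l, ((L.Γ l)ᴴ * L.Γ l * ρ + ρ * ((L.Γ l)ᴴ * L.Γ l))
        = L.cpMap 1 * ρ + ρ * L.cpMap 1 := by
      simp [Lindbladian.cpMap, Finset.sum_add_distrib, Matrix.sum_mul, Matrix.mul_sum]
    simp only [Lindbladian.gen, LinearMap.coe_mk, AddHom.coe_mk, Finset.sum_sub_distrib,
      ← Finset.smul_sum, this, h2, ← h1.eq]
    rw [← two_smul ℂ (ρ * L.cpMap 1), smul_smul]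
    simp
  rw [h4, smul_eq_zero, or_iff_right (by simp)] at h3
  exact (sub_eq_zero.mp h3).symm

theorem commute_dual_gen (h : DetailedBalance ρ L) {B : Matrix n n ℂ} (hB : Commute ρ B) :
    Commute ρ (dual L.gen B) := by
  have h1 := h.commute_cpMap (Commute.one_right ρ)
  have hH := h.commute_hamiltonian
  rw [Lindbladian.dual_gen]
  exact ((((hH.mul_right hB).sub_right (hB.mul_right hH)).smul_right _).add_right
    (h.commute_cpMap hB)).sub_right
    (((h1.mul_right hB).add_right (hB.mul_right h1)).smul_right _)

theorem commute_dual_gen_pow (h : DetailedBalance ρ L) {B : Matrix n n ℂ} (hB : Commute ρ B)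
    (k : ℕ) : Commute ρ ((dual L.gen ^ k) B) := by
  induction k with
  | zero => exact hB
  | succ k ih => rw [pow_succ']; exact h.commute_dual_gen ih

end DetailedBalance

/-! ### The semigroup: exponential, trace, positivity -/

section ExpSeries

variable {E : Type*} [NormedAddCommGroup E] [NormedSpace ℂ E] [FiniteDimensional ℂ E]

theorem tsum_exp_series_eq_exp (T : E →ₗ[ℂ] E) (c : ℂ) (x : E) :
    ∑' k : ℕ, ((k.factorial : ℂ)⁻¹ * c ^ k) • (T ^ k) x
      = NormedSpace.exp (c • LinearMap.toContinuousLinearMap T) x := by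
  have : CompleteSpace E := FiniteDimensional.complete ℂ E
  have h := (NormedSpace.exp_series_hasSum_exp' (𝕂 := ℂ)
    (c • LinearMap.toContinuousLinearMap T)).map
      (ContinuousLinearMap.apply ℂ E x) (ContinuousLinearMap.apply ℂ E x).continuous
  refine Eq.trans (tsum_congr fun k => ?_) h.tsum_eq
  have : ∀ (k : ℕ) (y : E), ((LinearMap.toContinuousLinearMap T) ^ k) y = (T ^ k) y := by
    intro k
    induction k with
    | zero => intro y; rfl
    | succ k ih => intro y; rw [pow_succ, pow_succ]; exact ih (T y)
  simp [smul_pow, this, mul_smul]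

theorem exp_smul_add_apply (T : E →ₗ[ℂ] E) (c d : ℂ) (x : E) :
    NormedSpace.exp ((c + d) • LinearMap.toContinuousLinearMap T) x
      = NormedSpace.exp (d • LinearMap.toContinuousLinearMap T)
        (NormedSpace.exp (c • LinearMap.toContinuousLinearMap T) x) := by
  have : CompleteSpace E := FiniteDimensional.complete ℂ E
  let : NormedAlgebra ℚ (E →L[ℂ] E) := NormedAlgebra.restrictScalars ℚ ℂ _
  rw [add_comm, add_smul, NormedSpace.exp_add_of_commute]
  · rfl
  · exact ((Commute.refl _).smul_left _).smul_right _

theorem hasDerivAt_exp_smul_apply [NormedSpace ℝ E] [IsScalarTower ℝ ℂ E]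
    (T : E →ₗ[ℂ] E) (t : ℝ) (x : E) :
    HasDerivAt (fun s : ℝ => NormedSpace.exp ((s : ℂ) • LinearMap.toContinuousLinearMap T) x)
      (T (NormedSpace.exp ((t : ℂ) • LinearMap.toContinuousLinearMap T) x)) t := by
  have : CompleteSpace E := FiniteDimensional.complete ℂ E
  have h := (hasDerivAt_exp_smul_const' (𝕂 := ℂ) (LinearMap.toContinuousLinearMap T) (t : ℂ))
  have h2 := (ContinuousLinearMap.apply ℂ E x).hasFDerivAt.comp_hasDerivAt (t : ℂ) h
  exact (h2.scomp t Complex.ofRealCLM.hasDerivAt).congr_deriv (by simp)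

end ExpSeries

section Evolution
open scoped Matrix.Norms.L2Operator

namespace Lindbladian

variable (L : Lindbladian n)

theorem evol_eq_exp (t : ℝ) (ρ : Matrix n n ℂ) :
    L.evol t ρ = NormedSpace.exp ((t : ℂ) • LinearMap.toContinuousLinearMap L.gen) ρ :=
  tsum_exp_series_eq_exp L.gen t ρ

theorem evol_zero (ρ : Matrix n n ℂ) : L.evol 0 ρ = ρ := by
  rw [evol_eq_exp, Complex.ofReal_zero]
  have := zero_smul ℂ (LinearMap.toContinuousLinearMap L.gen)
  erw [this, NormedSpace.exp_zero]
  rfl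

theorem evol_add (s t : ℝ) (ρ : Matrix n n ℂ) : L.evol (s + t) ρ = L.evol t (L.evol s ρ) := by
  simp only [evol_eq_exp, Complex.ofReal_add]
  exact exp_smul_add_apply L.gen s t ρ

theorem hasDerivAt_evol (t : ℝ) (ρ : Matrix n n ℂ) :
    HasDerivAt (fun s => L.evol s ρ) (L.gen (L.evol t ρ)) t := by
  simp only [evol_eq_exp]
  exact hasDerivAt_exp_smul_apply L.gen t ρ

theorem continuous_evol (ρ : Matrix n n ℂ) : Continuous fun s => L.evol s ρ :=
  continuous_iff_continuousAt.mpr fun t => (L.hasDerivAt_evol t ρ).continuousAt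

theorem evol_map_sub (t : ℝ) (A B : Matrix n n ℂ) :
    L.evol t (A - B) = L.evol t A - L.evol t B := by
  simp [evol_eq_exp]

theorem evol_map_sum {ι : Type*} (s : Finset ι) (t : ℝ) (A : ι → Matrix n n ℂ) :
    L.evol t (∑ i ∈ s, A i) = ∑ i ∈ s, L.evol t (A i) := by
  simp [evol_eq_exp]

theorem hasSum_bracket_evol (t : ℝ) (A B : Matrix n n ℂ) :
    HasSum (fun k : ℕ => bracket (((k.factorial : ℂ)⁻¹ * (t : ℂ) ^ k) • (L.gen ^ k) A) B)
      (bracket (L.evol t A) B) := by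
  have hc : Continuous fun A : Matrix n n ℂ => bracket A B := by
    unfold bracket; fun_prop
  exact (L.summable_evol t A).hasSum.map
    (AddMonoidHom.mk' (fun A : Matrix n n ℂ => bracket A B) fun X Y => by
      simp [bracket, add_mul]) hc

theorem bracket_evol_eq_zero {A B : Matrix n n ℂ} (h : ∀ k : ℕ, bracket ((L.gen ^ k) A) B = 0)
    (t : ℝ) : bracket (L.evol t A) B = 0 := by
  refine (L.hasSum_bracket_evol t A B).unique ?_
  convert! hasSum_zero (α := ℂ) (β := ℕ) with k
  have := h k
  simp only [bracket] at this
  simp [bracket, this]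

theorem trace_evol (t : ℝ) (ρ : Matrix n n ℂ) : (L.evol t ρ).trace = ρ.trace := by
  have h : ∀ s, HasDerivAt (fun s => (L.evol s ρ).trace) 0 s := fun s => by
    have := (((Matrix.traceLinearMap n ℂ ℂ).toContinuousLinearMap).restrictScalars ℝ).hasFDerivAt.comp_hasDerivAt
      s (L.hasDerivAt_evol s ρ)
    exact this.congr_deriv (L.trace_gen _)
  have := is_const_of_deriv_eq_zero (fun s => (h s).differentiableAt) (fun s => (h s).deriv) t 0
  simpa [evol_zero] using this

theorem conjTranspose_evol (t : ℝ) (ρ : Matrix n n ℂ) : (L.evol t ρ)ᴴ = L.evol t ρᴴ := by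
  have hp : ∀ k : ℕ, ((L.gen ^ k) ρ)ᴴ = (L.gen ^ k) ρᴴ := fun k => by
    induction k with
    | zero => rfl
    | succ k ih =>
      rw [pow_succ']
      exact (L.conjTranspose_gen _).trans (congrArg L.gen ih)
  rw [evol, Matrix.conjTranspose_tsum]
  refine tsum_congr fun k => ?_
  simp [hp]

theorem isHermitian_evol {ρ : Matrix n n ℂ} (h : ρ.IsHermitian) (t : ℝ) :
    (L.evol t ρ).IsHermitian := by
  rw [IsHermitian, conjTranspose_evol, h.eq]

end Lindbladian

omit [DecidableEq n] in
theorem isClosed_setOf_posSemidef : IsClosed {A : Matrix n n ℂ | A.PosSemidef} := by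
  simp only [posSemidef_iff_dotProduct_mulVec, Set.ofPred_and, Set.ofPred_forall]
  refine IsClosed.inter (isClosed_eq (by fun_prop) continuous_id) (isClosed_iInter fun x => ?_)
  exact isClosed_le continuous_const (by fun_prop)

open scoped MatrixOrder in
theorem _root_.Matrix.IsHermitian.posSemidef_smul_one_sub {A : Matrix n n ℂ} (hA : A.IsHermitian) {c : ℝ}
    (hc : ‖A‖ ≤ c) : ((c : ℂ) • (1 : Matrix n n ℂ) - A).PosSemidef := by
  have h := (show IsSelfAdjoint A from hA).le_algebraMap_norm_self
  rw [Matrix.le_iff] at h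
  have h2 : (((c - ‖A‖ : ℝ) : ℂ) • (1 : Matrix n n ℂ)).PosSemidef :=
    PosSemidef.one.smul (by exact_mod_cast sub_nonneg.mpr hc)
  have h3 : (c : ℂ) • (1 : Matrix n n ℂ) - A
      = (algebraMap ℝ (Matrix n n ℂ) ‖A‖ - A) + ((c - ‖A‖ : ℝ) : ℂ) • (1 : Matrix n n ℂ) := by
    have : algebraMap ℝ (Matrix n n ℂ) ‖A‖ = (‖A‖ : ℂ) • (1 : Matrix n n ℂ) := by
      ext i j; simp [Matrix.algebraMap_matrix_apply, Matrix.one_apply]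
    rw [this, Complex.ofReal_sub, sub_smul]
    abel
  rw [h3]
  exact h.add h2

namespace Lindbladian

variable (L : Lindbladian n)

/-- An Euler step is positive up to second order: the matrix equals `(1 + hK) X (1 + hK)⋆ + h ∑ Γ X
Γ⋆`, with `K` the drift. -/
theorem posSemidef_gen_step {X : Matrix n n ℂ} (hX : X.PosSemidef) {h : ℝ} (hh : 0 ≤ h) :
    (X + (h : ℂ) • L.gen X + ((h : ℂ) ^ 2) • (L.drift * X * L.driftᴴ)).PosSemidef := by
  have h1 : ((1 + (h : ℂ) • L.drift) * X * (1 + (h : ℂ) • L.drift)ᴴ).PosSemidef :=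
    hX.mul_mul_conjTranspose_same _
  have h2 : ((h : ℂ) • ∑ l, L.Γ l * X * (L.Γ l)ᴴ).PosSemidef :=
    (Matrix.posSemidef_sum _ fun l _ => hX.mul_mul_conjTranspose_same _).smul
      (by exact_mod_cast hh)
  convert h1.add h2 using 1
  simp only [gen_eq_drift, conjTranspose_add, conjTranspose_one, conjTranspose_smul, add_mul,
    mul_add, one_mul, mul_one, Matrix.smul_mul, Matrix.mul_smul, smul_smul, smul_add, pow_two]
  simp
  abel

/-- Continuous induction on time. The exponentially growing multiple of the identity is a barrier:
its growth over a step `h` beats `L(1)` and leaves a spare `h a`, which absorbs both the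
differentiability remainder and the quadratic Euler error. -/
theorem posSemidef_evol_add_exp {ρ : Matrix n n ℂ} (hρ : ρ.PosSemidef) {ε c : ℝ} (hε : 0 < ε)
    (hc : ‖L.gen 1‖ + 1 ≤ c) {t : ℝ} (ht : 0 ≤ t) :
    (L.evol t ρ + ((ε * Real.exp (c * t) : ℝ) : ℂ) • (1 : Matrix n n ℂ)).PosSemidef := by
  set X : ℝ → Matrix n n ℂ := fun s => L.evol s ρ + ((ε * Real.exp (c * s) : ℝ) : ℂ) • 1 with hXdef
  have hcont : Continuous X := (L.continuous_evol ρ).add (by fun_prop)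
  have hclosed : IsClosed {s : ℝ | (X s).PosSemidef} := isClosed_setOf_posSemidef.preimage hcont
  refine IsClosed.Icc_subset_of_forall_exists_gt (a := 0) (b := t)
    (s := {s : ℝ | (X s).PosSemidef}) (hclosed.inter isClosed_Icc) ?_ ?_ ⟨ht, le_rfl⟩
  · show (X 0).PosSemidef
    simp only [hXdef, evol_zero]
    exact hρ.add (PosSemidef.one.smul (by exact_mod_cast (by positivity)))
  rintro x ⟨hx, -⟩ y (hy : x < y)
  have hx : (X x).PosSemidef := hx
  set a := ε * Real.exp (c * x) with ha
  have ha0 : 0 < a := by positivity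
  have hderiv : HasDerivAt X (L.gen (X x) + (a : ℂ) • ((c : ℂ) • 1 - L.gen 1)) x := by
    have h1 := L.hasDerivAt_evol x ρ
    have h2 : HasDerivAt (fun s : ℝ => ε * Real.exp (c * s)) (a * c) x := by
      have := (((hasDerivAt_id x).const_mul c).exp).const_mul ε
      exact this.congr_deriv (by simp [ha]; ring)
    have h3 := (h2.ofReal_comp).smul_const (1 : Matrix n n ℂ)
    refine (h1.add h3).congr_deriv ?_
    simp only [hXdef, map_add, map_smul, smul_sub, smul_smul]
    have e1 : ((a * c : ℝ) : ℂ) = (a : ℂ) * c := by push_cast; rfl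
    rw [e1, ← ha]
    abel
  obtain ⟨δ, hδ, hδ'⟩ := Metric.eventually_nhds_iff.mp
    (hderiv.isLittleO.def (c := a / 2) (by positivity))
  set N := ‖L.drift * X x * L.driftᴴ‖ with hN
  have hN0 : 0 ≤ N := norm_nonneg _
  -- The bound `δ` keeps the remainder below `h a / 2`, the bound `a / (2(N+1))` does the same for
  -- the quadratic term, and `y - x` keeps the step inside the interval.
  obtain ⟨h, h0, hlt⟩ : ∃ h : ℝ, 0 < h ∧ h < min (min δ (y - x)) (a / (2 * (N + 1))) :=
    exists_between (lt_min (lt_min hδ (by linarith)) (by positivity))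
  rw [lt_min_iff, lt_min_iff] at hlt
  obtain ⟨⟨hlt1, hlt2⟩, hlt3⟩ := hlt
  refine ⟨x + h, ?_, by linarith, by linarith⟩
  show (X (x + h)).PosSemidef
  have hR := hδ' (y := x + h) (by simpa [abs_of_pos h0] using hlt1)
  have hreal : ∀ (r : ℝ) (A : Matrix n n ℂ), A.IsHermitian → ((r : ℂ) • A).IsHermitian :=
    fun r A hA => by rw [IsHermitian, conjTranspose_smul, hA.eq]; simp
  have hXh : ∀ s, (X s).IsHermitian := fun s =>
    (L.isHermitian_evol hρ.isHermitian s).add (hreal _ _ isHermitian_one)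
  have hgen : ∀ A : Matrix n n ℂ, A.IsHermitian → (L.gen A).IsHermitian := fun A hA => by
    rw [IsHermitian, conjTranspose_gen, hA.eq]
  set E : Matrix n n ℂ := (X x + (h : ℂ) • L.gen (X x) + ((h : ℂ) ^ 2) • (L.drift * X x * L.driftᴴ))
    + (h : ℂ) • ((a : ℂ) • ((c : ℂ) • 1 - L.gen 1)) - X (x + h) with hE
  have hEh : E.IsHermitian :=
    ((L.posSemidef_gen_step hx h0.le).isHermitian.add
      (hreal _ _ (hreal _ _ ((hreal _ _ isHermitian_one).sub (hgen _ isHermitian_one))))).sub (hXh _)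
  have hEn : ‖E‖ ≤ h * a := by
    have e : E = ((h : ℂ) ^ 2) • (L.drift * X x * L.driftᴴ) - (X (x + h) - X x - (x + h - x) •
        (L.gen (X x) + (a : ℂ) • ((c : ℂ) • 1 - L.gen 1))) := by
      have : ∀ A : Matrix n n ℂ, (x + h - x) • A = (h : ℂ) • A := fun A => by
        rw [add_sub_cancel_left]; ext i j; simp
      rw [hE, this, smul_add]
      abel
    rw [e]
    refine (norm_sub_le _ _).trans ?_
    have h1 : ‖((h : ℂ) ^ 2) • (L.drift * X x * L.driftᴴ)‖ ≤ h * (a / 2) := by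
      rw [norm_smul, norm_pow, Complex.norm_real, Real.norm_of_nonneg h0.le, ← hN, pow_two, mul_assoc]
      refine mul_le_mul_of_nonneg_left ?_ h0.le
      rw [lt_div_iff₀ (by positivity)] at hlt3
      nlinarith
    have h2 := hR
    rw [add_sub_cancel_left, Real.norm_of_nonneg h0.le] at h2
    rw [add_sub_cancel_left]
    calc _ ≤ h * (a / 2) + a / 2 * h := add_le_add h1 h2
      _ = h * a := by ring
  have hE1 := hEh.posSemidef_smul_one_sub hEn
  have hG : ((h : ℂ) • ((a : ℂ) • (((c - 1 : ℝ) : ℂ) • 1 - L.gen 1))).PosSemidef :=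
    (((hgen _ isHermitian_one).posSemidef_smul_one_sub (by linarith)).smul
      (by exact_mod_cast ha0.le)).smul (by exact_mod_cast h0.le)
  -- `X (x + h)` is the Euler step plus `h a (c - 1 - L(1))` plus `h a - E`, three positive
  -- semidefinite terms.
  have := ((L.posSemidef_gen_step hx h0.le).add hG).add hE1
  convert this using 1
  rw [hE]
  push_cast
  simp only [sub_smul, smul_sub, mul_smul, one_smul]
  abel

theorem posSemidef_evol {ρ : Matrix n n ℂ} (hρ : ρ.PosSemidef) {t : ℝ} (ht : 0 ≤ t) :
    (L.evol t ρ).PosSemidef := by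
  have h : Tendsto (fun ε : ℝ => L.evol t ρ
      + ((ε * Real.exp ((‖L.gen 1‖ + 1) * t) : ℝ) : ℂ) • (1 : Matrix n n ℂ)) (𝓝[>] 0)
      (𝓝 (L.evol t ρ)) := by
    have : Continuous fun ε : ℝ => L.evol t ρ
      + ((ε * Real.exp ((‖L.gen 1‖ + 1) * t) : ℝ) : ℂ) • (1 : Matrix n n ℂ) := by fun_prop
    have := (this.tendsto 0).mono_left (nhdsWithin_le_nhds (s := Set.Ioi 0))
    simpa using this
  exact isClosed_setOf_posSemidef.mem_of_tendsto h
    (eventually_nhdsWithin_of_forall fun ε hε => L.posSemidef_evol_add_exp hρ hε le_rfl ht)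

theorem isState_evol {ρ : Matrix n n ℂ} (hρ : IsState ρ) {t : ℝ} (ht : 0 ≤ t) :
    IsState (L.evol t ρ) :=
  ⟨L.posSemidef_evol hρ.1 ht, (L.trace_evol t ρ).trans hρ.2⟩

end Lindbladian

end Evolution

/-! ### Functional calculus in eigenbases and trace inequalities -/

section Spectral

theorem continuousOn_spectrum (A : Matrix n n ℂ) (g : ℝ → ℝ) : ContinuousOn g (spectrum ℝ A) :=
  (Matrix.finite_real_spectrum (A := A)).continuousOn g

theorem cfc_eq_conj {A : Matrix n n ℂ} (hA : A.IsHermitian) (f : ℝ → ℝ) :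
    cfc f A = (hA.eigenvectorUnitary : Matrix n n ℂ)
      * diagonal (fun i => (f (hA.eigenvalues i) : ℂ))
      * (hA.eigenvectorUnitary : Matrix n n ℂ)ᴴ := by
  rw [hA.cfc_eq, IsHermitian.cfc, Unitary.conjStarAlgAut_apply]
  rfl

/-- The expectation `⟨u_i | M | u_i⟩` of `M` in the `i`-th eigenvector of `A`. -/
noncomputable def eigenDiag {A : Matrix n n ℂ} (hA : A.IsHermitian) (M : Matrix n n ℂ) (i : n) :
    ℝ :=
  (((hA.eigenvectorUnitary : Matrix n n ℂ)ᴴ * M * (hA.eigenvectorUnitary : Matrix n n ℂ)) i i).re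

theorem eigenDiag_sum {A : Matrix n n ℂ} (hA : A.IsHermitian) {ι : Type*} (s : Finset ι)
    (M : ι → Matrix n n ℂ) (i : n) :
    eigenDiag hA (∑ j ∈ s, M j) i = ∑ j ∈ s, eigenDiag hA (M j) i := by
  simp [eigenDiag, Matrix.mul_sum, Matrix.sum_mul, Matrix.sum_apply]

theorem re_trace_mul_cfc {A : Matrix n n ℂ} (hA : A.IsHermitian) (M : Matrix n n ℂ) (f : ℝ → ℝ) :
    (M * cfc f A).trace.re = ∑ i, eigenDiag hA M i * f (hA.eigenvalues i) := by
  rw [cfc_eq_conj hA, ← mul_assoc, trace_mul_comm, ← mul_assoc, ← mul_assoc]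
  simp [trace, eigenDiag, mul_diagonal]

theorem re_trace_cfc {A : Matrix n n ℂ} (hA : A.IsHermitian) (f : ℝ → ℝ) :
    (cfc f A).trace.re = ∑ i, f (hA.eigenvalues i) := by
  have h : (hA.eigenvectorUnitary : Matrix n n ℂ)ᴴ * (hA.eigenvectorUnitary : Matrix n n ℂ) = 1 :=
    Unitary.coe_star_mul_self hA.eigenvectorUnitary
  have := re_trace_mul_cfc hA 1 f
  simpa [eigenDiag, h] using this

/-- The squared overlap of the `i`-th eigenvector of `A` and the `j`-th eigenvector of `B`. -/
noncomputable def overlap {A B : Matrix n n ℂ} (hA : A.IsHermitian) (hB : B.IsHermitian)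
    (i j : n) : ℝ :=
  Complex.normSq (((hA.eigenvectorUnitary : Matrix n n ℂ)ᴴ
    * (hB.eigenvectorUnitary : Matrix n n ℂ)) i j)

theorem re_trace_cfc_mul_cfc {A B : Matrix n n ℂ} (hA : A.IsHermitian) (hB : B.IsHermitian)
    (f g : ℝ → ℝ) :
    (cfc f A * cfc g B).trace.re
      = ∑ i, ∑ j, overlap hA hB i j * (f (hA.eigenvalues i) * g (hB.eigenvalues j)) := by
  set U := (hA.eigenvectorUnitary : Matrix n n ℂ) with hU
  set V := (hB.eigenvectorUnitary : Matrix n n ℂ) with hV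
  have e : (cfc f A * cfc g B).trace
      = (diagonal (fun i => (f (hA.eigenvalues i) : ℂ)) * ((Uᴴ * V)
        * diagonal (fun i => (g (hB.eigenvalues i) : ℂ)) * (Uᴴ * V)ᴴ)).trace := by
    rw [cfc_eq_conj hA, cfc_eq_conj hB, ← hU, ← hV, mul_assoc U, mul_assoc U, trace_mul_comm U,
      conjTranspose_mul, conjTranspose_conjTranspose]
    simp only [mul_assoc]
  rw [e]
  simp only [trace, diag_apply, diagonal_mul, mul_apply (M := _ * diagonal _), mul_diagonal,
    conjTranspose_apply, Complex.re_sum, Finset.mul_sum]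
  refine Finset.sum_congr rfl fun i _ => Finset.sum_congr rfl fun j _ => ?_
  rw [overlap, ← hU, ← hV]
  set z := (Uᴴ * V) i j
  have : (f (hA.eigenvalues i) : ℂ) * (z * (g (hB.eigenvalues j) : ℂ) * star z)
      = ((Complex.normSq z * (f (hA.eigenvalues i) * g (hB.eigenvalues j)) : ℝ) : ℂ) := by
    push_cast
    rw [← Complex.mul_conj]
    simp only [Complex.star_def]
    ring
  rw [this, Complex.ofReal_re]

/-- A form of Klein's inequality. -/
theorem re_trace_cfc_le {A B : Matrix n n ℂ} (hA : A.IsHermitian) (hB : B.IsHermitian)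
    {f φ d : ℝ → ℝ}
    (h : ∀ i j, f (hA.eigenvalues i)
      ≤ φ (hB.eigenvalues j) + hA.eigenvalues i * d (hB.eigenvalues j)) :
    (cfc f A).trace.re ≤ (cfc φ B).trace.re + (A * cfc d B).trace.re := by
  have h1 := re_trace_cfc_mul_cfc hA hB f 1
  have h2 := re_trace_cfc_mul_cfc hA hB 1 φ
  have h3 := re_trace_cfc_mul_cfc hA hB id d
  rw [cfc_one ℝ B (show IsSelfAdjoint B from hB), mul_one] at h1
  rw [cfc_one ℝ A (show IsSelfAdjoint A from hA), one_mul] at h2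
  rw [cfc_id ℝ A (show IsSelfAdjoint A from hA)] at h3
  rw [h1, h2, h3, ← Finset.sum_add_distrib]
  refine Finset.sum_le_sum fun i _ => ?_
  rw [← Finset.sum_add_distrib]
  refine Finset.sum_le_sum fun j _ => ?_
  rw [← mul_add]
  exact mul_le_mul_of_nonneg_left (by simpa using h i j) (Complex.normSq_nonneg _)

/-- The hypothesis says that `d` is a supergradient of `f`; Klein's inequality with `φ(y) = f(y) - y
d(y)` lifts the supporting line to matrices. -/
theorem re_trace_cfc_sub_le {A B : Matrix n n ℂ} (hA : A.PosSemidef) (hB : B.PosSemidef)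
    {f d : ℝ → ℝ} (h : ∀ x y, 0 ≤ x → 0 ≤ y → f x ≤ f y + (x - y) * d y) :
    (cfc f A).trace.re - (cfc f B).trace.re ≤ ((A - B) * cfc d B).trace.re := by
  have h1 := re_trace_cfc_le hA.1 hB.1 (f := f) (φ := fun y => f y - y * d y) (d := d) fun i j => by
    have := h _ _ (hA.eigenvalues_nonneg i) (hB.eigenvalues_nonneg j)
    linarith
  have h2 := re_trace_cfc_mul_cfc hB.1 hB.1 id d
  have hfin := continuousOn_spectrum B
  have h3 : cfc (fun y => f y - y * d y) B = cfc f B - B * cfc d B := by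
    rw [cfc_sub f (fun y => y * d y) B (hfin _) (hfin _), cfc_mul (fun y => y) d B (hfin _) (hfin _),
      cfc_id' ℝ B (show IsSelfAdjoint B from hB.1)]
  rw [h3] at h1
  simp only [trace_sub, Complex.sub_re, sub_mul] at h1 ⊢
  linarith

theorem eigenvalues_le_one {ρ : Matrix n n ℂ} (hρ : IsState ρ) (i : n) :
    hρ.1.1.eigenvalues i ≤ 1 := by
  have h := hρ.1.1.trace_eq_sum_eigenvalues
  have h2 : ∑ j, hρ.1.1.eigenvalues j = 1 := by
    simpa using congrArg Complex.re (h.symm.trans hρ.2)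
  exact h2 ▸ Finset.single_le_sum (fun j _ => hρ.1.eigenvalues_nonneg j) (Finset.mem_univ i)

theorem spectrum_subset_Icc {ρ : Matrix n n ℂ} (hρ : IsState ρ) :
    spectrum ℝ ρ ⊆ Set.Icc 0 1 := by
  rw [hρ.1.1.spectrum_real_eq_range_eigenvalues]
  rintro _ ⟨i, rfl⟩
  exact ⟨hρ.1.eigenvalues_nonneg i, eigenvalues_le_one hρ i⟩

end Spectral

/-! ### Derivatives of trace functions and monotone limits -/

section Derivative
open scoped Matrix.Norms.L2Operator

theorem continuousOn_cfc_of_isState {A : ℝ → Matrix n n ℂ} {d : ℝ → ℝ} {s : Set ℝ}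
    (hA : ∀ t ∈ s, IsState (A t)) (hd : ContinuousOn d (Set.Icc 0 1)) (hc : ContinuousOn A s) :
    ContinuousOn (fun t => cfc d (A t)) s :=
  ContinuousOn.cfc' isCompact_Icc d hc (fun t ht => spectrum_subset_Icc (hA t ht))
    (fun t ht => (hA t ht).1.1) hd

/-- Using the supergradient inequality in both directions traps the difference quotient between two
traces, with `d (A t)` and `d (A u)`. Both converge to the claimed value by continuity of `d`, so no
perturbation theory of eigenvalues is needed. -/
theorem hasDerivWithinAt_trace_cfc {A : ℝ → Matrix n n ℂ} {A' : Matrix n n ℂ} {f d : ℝ → ℝ}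
    {s : Set ℝ} {t : ℝ} (ht : t ∈ s) (hA : ∀ u ∈ s, IsState (A u))
    (hd : ContinuousOn d (Set.Icc 0 1)) (hf : ∀ x y, 0 ≤ x → 0 ≤ y → f x ≤ f y + (x - y) * d y)
    (hc : ContinuousOn A s) (hA' : HasDerivWithinAt A A' s t) :
    HasDerivWithinAt (fun u => (cfc f (A u)).trace.re) ((A' * cfc d (A t)).trace.re) s t := by
  rw [hasDerivWithinAt_iff_tendsto_slope] at hA' ⊢
  have hre : Continuous fun M : Matrix n n ℂ => M.trace.re :=
    Complex.continuous_re.comp (by fun_prop)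
  have hcd := ((continuousOn_cfc_of_isState hA hd hc) t ht).mono_left
    (nhdsWithin_mono t Set.sdiff_subset : 𝓝[s \ {t}] t ≤ 𝓝[s] t)
  have h1 := (hre.tendsto _).comp (hA'.mul_const (cfc d (A t)))
  have h2 := (hre.tendsto _).comp (hA'.mul hcd)
  have hmin := h1.min h2
  have hmax := h1.max h2
  rw [min_self] at hmin
  rw [max_self] at hmax
  have hsl : ∀ (u : ℝ) (X : Matrix n n ℂ), (slope A t u * X).trace.re
      = (u - t)⁻¹ * ((A u - A t) * X).trace.re := fun u X => by
    have : slope A t u = (((u - t)⁻¹ : ℝ) : ℂ) • (A u - A t) := by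
      rw [slope_def_module]; ext i j; simp
    rw [this, Matrix.smul_mul, trace_smul, smul_eq_mul, Complex.re_ofReal_mul]
  have key : ∀ u ∈ s \ {t}, min ((slope A t u * cfc d (A t)).trace.re)
        ((slope A t u * cfc d (A u)).trace.re) ≤ slope (fun u => (cfc f (A u)).trace.re) t u ∧
      slope (fun u => (cfc f (A u)).trace.re) t u ≤ max ((slope A t u * cfc d (A t)).trace.re)
        ((slope A t u * cfc d (A u)).trace.re) := by
    rintro u ⟨hu, hut⟩
    have i1 := re_trace_cfc_sub_le (hA u hu).1 (hA t ht).1 hf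
    have i2 := re_trace_cfc_sub_le (hA t ht).1 (hA u hu).1 hf
    have i3 : ((A t - A u) * cfc d (A u)).trace.re = - ((A u - A t) * cfc d (A u)).trace.re := by
      rw [← neg_sub, neg_mul, trace_neg, Complex.neg_re]
    rw [i3] at i2
    rw [hsl, hsl, slope_def_field, div_eq_inv_mul]
    rcases lt_or_gt_of_ne hut with h | h
    · have h' : (u - t)⁻¹ ≤ 0 := inv_nonpos.mpr (by linarith)
      exact ⟨min_le_of_left_le (mul_le_mul_of_nonpos_left i1 h'),
        le_max_of_le_right (mul_le_mul_of_nonpos_left (by linarith) h')⟩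
    · have h' : 0 ≤ (u - t)⁻¹ := inv_nonneg.mpr (by linarith)
      exact ⟨min_le_of_right_le (mul_le_mul_of_nonneg_left (by linarith) h'),
        le_max_of_le_left (mul_le_mul_of_nonneg_left i1 h')⟩
  exact tendsto_of_tendsto_of_tendsto_of_le_of_le' hmin hmax
    (eventually_nhdsWithin_of_forall fun u hu => (key u hu).1)
    (eventually_nhdsWithin_of_forall fun u hu => (key u hu).2)

end Derivative

/-- The fundamental theorem of calculus holds for each `G k`; convergence of the increments bounds
the integrals of the increasing `h k`, so their limit is finite almost everywhere and integrable.
One `w` serves all `t`. -/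
theorem exists_integral_eq_sub_of_monotone_deriv {F : ℝ → ℝ} {G h : ℕ → ℝ → ℝ}
    (hd : ∀ k s, 0 ≤ s → HasDerivWithinAt (G k) (h k s) (Set.Ici 0) s)
    (hc : ∀ k, ContinuousOn (h k) (Set.Ici 0))
    (hm : ∀ s, 0 ≤ s → Monotone fun k => h k s)
    (hF : ∀ s, 0 ≤ s → Tendsto (fun k => G k s) atTop (𝓝 (F s))) :
    ∃ w : ℝ → ℝ, ∀ t, 0 ≤ t →
      IntervalIntegrable w volume 0 t ∧ ∫ s in (0 : ℝ)..t, w s = F t - F 0 := by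
  -- Subtracting `h 0` makes the sequence nonnegative; the supremum can be infinite only on a null
  -- set, where `toReal` is harmless.
  set u : ℝ → ENNReal := fun s => ⨆ k, ENNReal.ofReal (h k s - h 0 s) with hu
  refine ⟨fun s => h 0 s + (u s).toReal, fun t ht => ?_⟩
  set μ := volume.restrict (Set.Ioc 0 t) with hμ
  have hci : ∀ k, IntervalIntegrable (h k) volume 0 t := fun k =>
    ((hc k).mono (by rw [Set.uIcc_of_le ht]; exact Set.Icc_subset_Ici_self)).intervalIntegrable
  have hi : ∀ k, Integrable (h k) μ := fun k =>
    (intervalIntegrable_iff_integrableOn_Ioc_of_le ht).mp (hci k)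
  have hFTC : ∀ k, ∫ s, h k s ∂μ = G k t - G k 0 := fun k => by
    rw [hμ, ← intervalIntegral.integral_of_le ht]
    refine intervalIntegral.integral_eq_sub_of_hasDeriv_right ?_ ?_ (hci k)
    · rw [Set.uIcc_of_le ht]
      exact fun s hs => ((hd k s hs.1).continuousWithinAt).mono Set.Icc_subset_Ici_self
    · rw [min_eq_left ht]
      exact fun s hs => (hd k s hs.1.le).mono fun x hx => hs.1.le.trans (le_of_lt hx)
  have hpos : ∀ᵐ s ∂μ, 0 ≤ s :=
    (ae_restrict_mem measurableSet_Ioc).mono fun s hs => hs.1.le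
  have hmono : ∀ᵐ s ∂μ, Monotone fun k => h k s := hpos.mono fun s hs => hm s hs
  have hlim : Tendsto (fun k => G k t - G k 0) atTop (𝓝 (F t - F 0)) :=
    (hF t ht).sub (hF 0 le_rfl)
  have humeas : ∀ k, AEMeasurable (fun s => ENNReal.ofReal (h k s - h 0 s)) μ := fun k =>
    ((hi k).sub (hi 0)).aemeasurable.ennreal_ofReal
  have hutend : ∀ᵐ s ∂μ, Tendsto (fun k => ENNReal.ofReal (h k s - h 0 s)) atTop (𝓝 (u s)) :=
    hmono.mono fun s hs => tendsto_atTop_iSup fun k l hkl =>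
      ENNReal.ofReal_le_ofReal (sub_le_sub_right (hs hkl) _)
  have hint : Tendsto (fun k => ∫⁻ s, ENNReal.ofReal (h k s - h 0 s) ∂μ) atTop
      (𝓝 (∫⁻ s, u s ∂μ)) :=
    lintegral_tendsto_of_tendsto_of_monotone humeas
      (hmono.mono fun s hs k l hkl => ENNReal.ofReal_le_ofReal (sub_le_sub_right (hs hkl) _)) hutend
  have hint2 : ∀ k, ∫⁻ s, ENNReal.ofReal (h k s - h 0 s) ∂μ
      = ENNReal.ofReal (G k t - G k 0 - (G 0 t - G 0 0)) := fun k => by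
    rw [← hFTC, ← hFTC, ← integral_sub (hi k) (hi 0)]
    exact (ofReal_integral_eq_lintegral_ofReal ((hi k).sub (hi 0))
      (hmono.mono fun s hs => sub_nonneg.mpr (hs (Nat.zero_le k)))).symm
  simp only [hint2] at hint
  have hu_ne : ∫⁻ s, u s ∂μ ≠ ⊤ := by
    rw [tendsto_nhds_unique hint
      ((ENNReal.continuous_ofReal.tendsto _).comp (hlim.sub_const (G 0 t - G 0 0)))]
    exact ENNReal.ofReal_ne_top
  have huae : AEMeasurable u μ := AEMeasurable.iSup humeas
  have hw : Integrable (fun s => h 0 s + (u s).toReal) μ :=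
    (hi 0).add (integrable_toReal_of_lintegral_ne_top huae hu_ne)
  have hwt : ∀ᵐ s ∂μ, Tendsto (fun k => h k s) atTop (𝓝 (h 0 s + (u s).toReal)) := by
    filter_upwards [hutend, ae_lt_top' huae hu_ne, hmono] with s h1 h2 h3
    have h4 := ((ENNReal.tendsto_toReal h2.ne).comp h1).const_add (h 0 s)
    refine h4.congr fun k => ?_
    rw [Function.comp_apply, ENNReal.toReal_ofReal (sub_nonneg.mpr (h3 (Nat.zero_le k)))]
    ring
  have h5 := integral_tendsto_of_tendsto_of_monotone hi hw hmono hwt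
  simp only [hFTC] at h5
  refine ⟨(intervalIntegrable_iff_integrableOn_Ioc_of_le ht).mpr hw, ?_⟩
  rw [intervalIntegral.integral_of_le ht]
  exact tendsto_nhds_unique h5 hlim

/-! ### Regularized entropy and its monotonicity in the regularization -/

theorem negMulLog_le_sub_sub {a b : ℝ} (ha : 0 ≤ a) (hb : 0 < b) :
    Real.negMulLog a ≤ b - a - a * Real.log b := by
  rcases ha.eq_or_lt with rfl | ha
  · simpa using hb.le
  · have h := Real.log_le_sub_one_of_pos (div_pos hb ha)
    rw [Real.log_div hb.ne' ha.ne'] at h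
    have h2 := mul_le_mul_of_nonneg_left h ha.le
    have h3 : a * (b / a - 1) = b - a := by field_simp
    rw [h3] at h2
    simp only [Real.negMulLog]
    linarith

theorem vonNeumannEntropy_eq {ρ : Matrix n n ℂ} (hρ : ρ.IsHermitian) :
    vonNeumannEntropy ρ = (cfc Real.negMulLog ρ).trace.re := by
  have hfin := continuousOn_spectrum ρ
  have h : cfc Real.negMulLog ρ = -(ρ * cfc Real.log ρ) := by
    have e : Real.negMulLog = fun x => -(x * Real.log x) := by
      funext x; simp [Real.negMulLog]
    rw [e, cfc_neg, cfc_mul (fun x => x) Real.log ρ (hfin _) (hfin _),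
      cfc_id' ℝ ρ (show IsSelfAdjoint ρ from hρ)]
  rw [h, vonNeumannEntropy, bracket, hρ.eq, matLog, trace_neg, Complex.neg_re]

/-- The regularized entropy `tr f_ε(ρ)` with `f_ε(x) = -(x + ε) log (x + ε)`. -/
noncomputable def regEntropy (ε : ℝ) (ρ : Matrix n n ℂ) : ℝ :=
  (cfc (fun x => Real.negMulLog (x + ε)) ρ).trace.re

/-- The derivative of the regularized entropy at `ρ` in the direction `M`. -/
noncomputable def regEntropyRate (ε : ℝ) (M ρ : Matrix n n ℂ) : ℝ :=
  (M * cfc (fun x => -Real.log (x + ε) - 1) ρ).trace.re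

theorem tendsto_regEntropy {ρ : Matrix n n ℂ} (hρ : ρ.IsHermitian) :
    Tendsto (fun ε => regEntropy ε ρ) (𝓝 0) (𝓝 (vonNeumannEntropy ρ)) := by
  rw [vonNeumannEntropy_eq hρ, re_trace_cfc hρ]
  simp only [regEntropy, re_trace_cfc hρ]
  have : Continuous fun ε : ℝ => ∑ i, Real.negMulLog (hρ.eigenvalues i + ε) :=
    continuous_finsetSum _ fun i _ => Real.continuous_negMulLog.comp (by fun_prop)
  simpa using this.tendsto 0

theorem hasDerivWithinAt_regEntropy {A : ℝ → Matrix n n ℂ} {A' : Matrix n n ℂ} {s : Set ℝ}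
    {t ε : ℝ} (hε : 0 < ε) (ht : t ∈ s) (hA : ∀ u ∈ s, IsState (A u)) (hc : ContinuousOn A s)
    (hA' : HasDerivWithinAt A A' s t) :
    HasDerivWithinAt (fun u => regEntropy ε (A u)) (regEntropyRate ε A' (A t)) s t := by
  refine hasDerivWithinAt_trace_cfc ht hA ?_ (fun x y hx hy => ?_) hc hA'
  · exact (ContinuousOn.log (by fun_prop) fun x hx => by linarith [hx.1]).neg.sub
      continuousOn_const
  · have h := negMulLog_le_sub_sub (a := x + ε) (b := y + ε) (by linarith) (by linarith)
    have h2 : Real.negMulLog (y + ε) = -(y + ε) * Real.log (y + ε) := rfl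
    rw [h2]
    linarith

theorem continuousOn_regEntropyRate {A B : ℝ → Matrix n n ℂ} {s : Set ℝ} {ε : ℝ} (hε : 0 < ε)
    (hA : ∀ u ∈ s, IsState (A u)) (hc : ContinuousOn A s) (hB : ContinuousOn B s) :
    ContinuousOn (fun u => regEntropyRate ε (B u) (A u)) s := by
  have h := continuousOn_cfc_of_isState (d := fun x => -Real.log (x + ε) - 1) hA
    ((ContinuousOn.log (by fun_prop) fun x hx => by linarith [hx.1]).neg.sub
      continuousOn_const) hc
  have hre : Continuous fun M : Matrix n n ℂ => M.trace.re :=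
    Complex.continuous_re.comp (by fun_prop)
  exact hre.comp_continuousOn (hB.mul h)

namespace Lindbladian

variable (L : Lindbladian n)

/-- In an eigenbasis of `ρ` the drift contributes `2 p_i Re K_ii` and the jump term is nonnegative.
Entries of a unitary have modulus at most one, which bounds `K_ii` independently of `ρ`. -/
theorem exists_le_eigenDiag_gen : ∃ C : ℝ, 0 ≤ C ∧ ∀ (ρ : Matrix n n ℂ) (hρ : ρ.PosSemidef) (i : n),
    -C * hρ.1.eigenvalues i ≤ eigenDiag hρ.1 (L.gen ρ) i := by
  refine ⟨2 * ∑ j, ∑ k, ‖L.drift j k‖, by positivity, fun ρ hρ i => ?_⟩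
  set U := (hρ.1.eigenvectorUnitary : Matrix n n ℂ) with hU
  set p := hρ.1.eigenvalues with hp
  have hUU : Uᴴ * U = 1 := Unitary.coe_star_mul_self hρ.1.eigenvectorUnitary
  have hspec : ρ = U * diagonal (fun i => (p i : ℂ)) * Uᴴ := by
    have := cfc_eq_conj hρ.1 (fun x => x)
    rwa [cfc_id' ℝ ρ (show IsSelfAdjoint ρ from hρ.1)] at this
  have h1 : ρ * U = U * diagonal (fun i => (p i : ℂ)) := by
    conv_lhs => rw [hspec]
    rw [mul_assoc, hUU, mul_one]
  have h2 : Uᴴ * ρ = diagonal (fun i => (p i : ℂ)) * Uᴴ := by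
    conv_lhs => rw [hspec]
    rw [← mul_assoc, ← mul_assoc, hUU, one_mul]
  set K := Uᴴ * L.drift * U with hK
  have hpos : 0 ≤ ((Uᴴ * (∑ l, L.Γ l * ρ * (L.Γ l)ᴴ) * U) i i).re := by
    have h : (Uᴴ * (∑ l, L.Γ l * ρ * (L.Γ l)ᴴ) * U).PosSemidef :=
      (Matrix.posSemidef_sum _ fun l _ => hρ.mul_mul_conjTranspose_same _).conjTranspose_mul_mul_same U
    exact (Complex.le_def.mp (h.diag_nonneg (i := i))).1
  have hdec : Uᴴ * L.gen ρ * U = K * diagonal (fun i => (p i : ℂ))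
      + diagonal (fun i => (p i : ℂ)) * Kᴴ + Uᴴ * (∑ l, L.Γ l * ρ * (L.Γ l)ᴴ) * U := by
    rw [gen_eq_drift, mul_add, mul_add, add_mul, add_mul]
    congr 2
    · rw [mul_assoc, mul_assoc, h1, hK]; simp only [mul_assoc]
    · rw [← mul_assoc, h2, hK]
      simp only [conjTranspose_mul, conjTranspose_conjTranspose, mul_assoc]
  have hval : eigenDiag hρ.1 (L.gen ρ) i = 2 * (p i * (K i i).re)
      + ((Uᴴ * (∑ l, L.Γ l * ρ * (L.Γ l)ᴴ) * U) i i).re := by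
    rw [eigenDiag, ← hU, hdec]
    simp [mul_diagonal, diagonal_mul]
    ring
  have hent : ∀ j k, ‖U j k‖ ≤ 1 :=
    entry_norm_bound_of_unitary hρ.1.eigenvectorUnitary.2
  have hKn : ‖K i i‖ ≤ ∑ j, ∑ k, ‖L.drift j k‖ := by
    have : K i i = ∑ k, ∑ j, star (U j i) * L.drift j k * U k i := by
      simp [hK, mul_apply, Finset.sum_mul]
    rw [this, Finset.sum_comm]
    refine (norm_sum_le _ _).trans (Finset.sum_le_sum fun j _ =>
      (norm_sum_le _ _).trans (Finset.sum_le_sum fun k _ => ?_))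
    rw [norm_mul, norm_mul, norm_star]
    calc _ ≤ 1 * ‖L.drift j k‖ * 1 := by gcongr <;> exact hent _ _
      _ = _ := by ring
  have hre : -(∑ j, ∑ k, ‖L.drift j k‖) ≤ (K i i).re :=
    (neg_le_neg hKn).trans (neg_le_of_abs_le (Complex.abs_re_le_norm _))
  have := mul_le_mul_of_nonneg_left hre (hρ.eigenvalues_nonneg i)
  rw [hval]
  linarith

/-- Writing `l ≥ -C p` for a diagonal entry of `L ρ`, the `ε`-derivative of `-l log (p + ε)` is at
most `C p / (p + ε) ≤ C`. The proof uses the integrated form, through `log x ≤ x - 1`, and sums over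
the eigenvectors. -/
theorem exists_regEntropyRate_antitone : ∃ C : ℝ, ∀ ρ : Matrix n n ℂ, ρ.PosSemidef →
    ∀ ε δ : ℝ, 0 < ε → ε ≤ δ →
      regEntropyRate δ (L.gen ρ) ρ - C * δ ≤ regEntropyRate ε (L.gen ρ) ρ - C * ε := by
  obtain ⟨C, hC, h⟩ := L.exists_le_eigenDiag_gen
  refine ⟨Fintype.card n * C, fun ρ hρ ε δ hε hεδ => ?_⟩
  have key : ∀ i, eigenDiag hρ.1 (L.gen ρ) i * (-Real.log (hρ.1.eigenvalues i + δ) - 1) - C * δ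
      ≤ eigenDiag hρ.1 (L.gen ρ) i * (-Real.log (hρ.1.eigenvalues i + ε) - 1) - C * ε := by
    intro i
    have hl := h ρ hρ i
    have hp := hρ.eigenvalues_nonneg i
    set p := hρ.1.eigenvalues i
    set l := eigenDiag hρ.1 (L.gen ρ) i
    have h0 : Real.log (p + ε) ≤ Real.log (p + δ) :=
      Real.log_le_log (by linarith) (by linarith)
    have h1 : p * (Real.log (p + δ) - Real.log (p + ε)) ≤ δ - ε := by
      have h2 := Real.log_le_sub_one_of_pos (x := (p + δ) / (p + ε)) (by apply div_pos <;> linarith)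
      rw [Real.log_div (by linarith) (by linarith)] at h2
      have h3 : (p + δ) / (p + ε) - 1 = (δ - ε) / (p + ε) := by
        have : p + ε ≠ 0 := by linarith
        field_simp
        ring
      rw [h3] at h2
      calc _ ≤ (p + ε) * (Real.log (p + δ) - Real.log (p + ε)) :=
            mul_le_mul_of_nonneg_right (by linarith) (by linarith)
        _ ≤ (p + ε) * ((δ - ε) / (p + ε)) := mul_le_mul_of_nonneg_left h2 (by linarith)
        _ = δ - ε := by
          have : p + ε ≠ 0 := by linarith
          field_simp
    have h4 := mul_le_mul_of_nonneg_right hl (sub_nonneg.mpr h0)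
    have h5 := mul_le_mul_of_nonneg_left h1 hC
    linarith
  have := Finset.sum_le_sum fun i (_ : i ∈ Finset.univ) => key i
  simp only [Finset.sum_sub_distrib, Finset.sum_const, nsmul_eq_mul, Finset.card_univ] at this
  simp only [regEntropyRate, re_trace_mul_cfc hρ.1]
  linarith

variable {L} {ρ : Matrix n n ℂ}

open scoped Matrix.Norms.L2Operator in
theorem hasDerivWithinAt_regEntropy_evol (hρ : IsState ρ) {ε : ℝ} (hε : 0 < ε) {t : ℝ}
    (ht : 0 ≤ t) : HasDerivWithinAt (fun s => regEntropy ε (L.evol s ρ))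
      (regEntropyRate ε (L.gen (L.evol t ρ)) (L.evol t ρ)) (Set.Ici 0) t :=
  hasDerivWithinAt_regEntropy hε ht (fun _ hu => L.isState_evol hρ hu)
    (L.continuous_evol ρ).continuousOn (L.hasDerivAt_evol t ρ).hasDerivWithinAt

theorem continuousOn_regEntropyRate_evol (hρ : IsState ρ) {ε : ℝ} (hε : 0 < ε) :
    ContinuousOn (fun t => regEntropyRate ε (L.gen (L.evol t ρ)) (L.evol t ρ)) (Set.Ici 0) :=
  continuousOn_regEntropyRate hε (fun _ hu => L.isState_evol hρ hu)
    (L.continuous_evol ρ).continuousOn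
    ((LinearMap.continuous_of_finiteDimensional L.gen).comp (L.continuous_evol ρ)).continuousOn

theorem exists_integral_eq_entropy_sub (hρ : IsState ρ) : ∃ w : ℝ → ℝ, ∀ t, 0 ≤ t →
    IntervalIntegrable w volume 0 t ∧
      ∫ s in (0 : ℝ)..t, w s = vonNeumannEntropy (L.evol t ρ) - vonNeumannEntropy ρ := by
  obtain ⟨C, hC⟩ := L.exists_regEntropyRate_antitone
  set ε : ℕ → ℝ := fun k => 1 / ((k : ℝ) + 1) with hε
  have hε0 : ∀ k, 0 < ε k := fun k => Nat.one_div_pos_of_nat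
  have hεt : Tendsto ε atTop (𝓝 0) := tendsto_one_div_add_atTop_nhds_zero_nat
  have := exists_integral_eq_sub_of_monotone_deriv
    (F := fun t => vonNeumannEntropy (L.evol t ρ))
    (G := fun k t => regEntropy (ε k) (L.evol t ρ) - C * ε k * t)
    (h := fun k t => regEntropyRate (ε k) (L.gen (L.evol t ρ)) (L.evol t ρ) - C * ε k)
    (fun k s hs => by
      have h := (hasDerivAt_id s).hasDerivWithinAt (s := Set.Ici 0)
      exact ((hasDerivWithinAt_regEntropy_evol hρ (hε0 k) hs).sub (h.const_mul (C * ε k))).congr_deriv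
        (by simp))
    (fun k => (continuousOn_regEntropyRate_evol hρ (hε0 k)).sub continuousOn_const)
    (fun s hs k l hkl => hC _ (L.posSemidef_evol hρ.1 hs) _ _ (hε0 l)
      (one_div_le_one_div_of_le (by positivity) (by exact_mod_cast Nat.succ_le_succ hkl)))
    (fun s hs => by
      have h1 := (tendsto_regEntropy (L.isHermitian_evol hρ.1.1 s)).comp hεt
      have h2 : Tendsto (fun k => C * ε k * s) atTop (𝓝 (C * 0 * s)) :=
        (hεt.const_mul C).mul_const s
      simpa using h1.sub h2)
  simpa [evol_zero] using this

/-- For `ε ≤ δ` the difference of the two corrected regularized entropies is nondecreasing in time;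
then `ε` tends to zero. This bounds entropy growth from below by a differentiable quantity. -/
theorem exists_entropy_sub_ge (L : Lindbladian n) : ∃ C : ℝ, ∀ ρ : Matrix n n ℂ, IsState ρ →
    ∀ δ t : ℝ, 0 < δ → 0 ≤ t →
      regEntropy δ (L.evol t ρ) - regEntropy δ ρ - C * δ * t
        ≤ vonNeumannEntropy (L.evol t ρ) - vonNeumannEntropy ρ := by
  obtain ⟨C, hC⟩ := L.exists_regEntropyRate_antitone
  refine ⟨C, fun ρ hρ δ t hδ ht => ?_⟩
  have key : ∀ ε ∈ Set.Ioo 0 δ, regEntropy δ (L.evol t ρ) - regEntropy δ ρ - C * δ * t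
      ≤ regEntropy ε (L.evol t ρ) - regEntropy ε ρ - C * ε * t := by
    rintro ε ⟨h0, h1⟩
    have hd : ∀ s, 0 ≤ s → HasDerivWithinAt (fun s => regEntropy ε (L.evol s ρ) - C * ε * s
        - (regEntropy δ (L.evol s ρ) - C * δ * s))
        ((regEntropyRate ε (L.gen (L.evol s ρ)) (L.evol s ρ) - C * ε)
          - (regEntropyRate δ (L.gen (L.evol s ρ)) (L.evol s ρ) - C * δ)) (Set.Ici 0) s := by
      intro s hs
      have h := (hasDerivAt_id s).hasDerivWithinAt (s := Set.Ici 0)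
      exact (((hasDerivWithinAt_regEntropy_evol hρ h0 hs).sub (h.const_mul (C * ε))).sub
        ((hasDerivWithinAt_regEntropy_evol hρ hδ hs).sub (h.const_mul (C * δ)))).congr_deriv
        (by simp)
    have hmono := monotoneOn_of_deriv_nonneg (convex_Ici (0 : ℝ))
      (fun s hs => (hd s hs).continuousWithinAt)
      (fun s hs => by
        rw [interior_Ici] at hs
        exact ((hd s (le_of_lt hs)).hasDerivAt (Ici_mem_nhds hs)).differentiableAt.differentiableWithinAt)
      (fun s hs => by
        rw [interior_Ici] at hs
        rw [((hd s (le_of_lt hs)).hasDerivAt (Ici_mem_nhds hs)).deriv]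
        exact sub_nonneg.mpr (hC _ (L.posSemidef_evol hρ.1 (le_of_lt hs)) _ _ h0 h1.le))
    have := hmono (Set.mem_Ici.mpr le_rfl) ht ht
    simp only [evol_zero, mul_zero, sub_zero] at this
    linarith
  have hlim : Tendsto (fun ε => regEntropy ε (L.evol t ρ) - regEntropy ε ρ - C * ε * t) (𝓝[>] 0)
      (𝓝 (vonNeumannEntropy (L.evol t ρ) - vonNeumannEntropy ρ - C * 0 * t)) := by
    refine Tendsto.mono_left ?_ nhdsWithin_le_nhds
    exact ((tendsto_regEntropy (L.isHermitian_evol hρ.1.1 t)).sub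
      (tendsto_regEntropy hρ.1.1)).sub ((tendsto_id.const_mul C).mul_const t)
  simp only [mul_zero, zero_mul, sub_zero] at hlim
  exact ge_of_tendsto hlim (eventually_of_mem (Ioo_mem_nhdsGT hδ) key)

end Lindbladian

/-! ### Two-time measurement statistics -/

section SpectralProjections

variable {S : Matrix n n ℂ}

theorem sum_cfc_indicator (S : Matrix n n ℂ) (g : ℝ → ℝ) :
    ∑ s ∈ spec S, (g s : ℂ) • specProj S s = cfc g S := by
  have h1 : ∀ s, (g s : ℂ) • specProj S s = cfc (fun x => g s * if x = s then (1 : ℝ) else 0) S := by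
    intro s
    rw [cfc_const_mul (g s) _ S (continuousOn_spectrum S _), specProj]
    ext i j
    simp
  simp only [h1]
  rw [← cfc_sum _ S _ fun s _ => continuousOn_spectrum S _]
  refine cfc_congr fun x hx => ?_
  have hx' : x ∈ spec S := by simpa [spec] using hx
  simp only [Finset.sum_apply, mul_ite, mul_one, mul_zero]
  rw [Finset.sum_ite_eq, if_pos hx']

theorem sum_specProj (hS : S.IsHermitian) : ∑ s ∈ spec S, specProj S s = 1 := by
  have := sum_cfc_indicator S fun _ => 1
  rw [cfc_const_one ℝ S (show IsSelfAdjoint S from hS)] at this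
  simpa using this

theorem sum_smul_specProj (hS : S.IsHermitian) : ∑ s ∈ spec S, (s : ℂ) • specProj S s = S := by
  have := sum_cfc_indicator S fun x => x
  rwa [cfc_id' ℝ S (show IsSelfAdjoint S from hS)] at this

theorem specProj_mul_self (S : Matrix n n ℂ) (s : ℝ) :
    specProj S s * specProj S s = specProj S s := by
  rw [specProj, ← cfc_mul _ _ S (continuousOn_spectrum S _) (continuousOn_spectrum S _)]
  congr 1
  funext x
  split_ifs <;> simp

theorem bracket_dephasing {A X : Matrix n n ℂ} (hS : S.IsHermitian) (hX : Commute S X) :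
    bracket (∑ s ∈ spec S, specProj S s * A * specProj S s) X = bracket A X := by
  have hP : ∀ s, (specProj S s)ᴴ = specProj S s := fun s => by
    have : IsSelfAdjoint (specProj S s) := cfc_predicate _ _
    exact this
  have h1 : ∀ s, ((specProj S s * A * specProj S s)ᴴ * X).trace
      = (Aᴴ * (X * specProj S s)).trace := fun s => by
    have hc : Commute (specProj S s) X := hX.cfc_real _
    rw [conjTranspose_mul, conjTranspose_mul, hP, mul_assoc, trace_mul_comm]
    simp only [mul_assoc]
    rw [← hc.eq, ← mul_assoc (specProj S s), specProj_mul_self, hc.eq]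
  simp only [bracket, conjTranspose_sum, Matrix.sum_mul, trace_sum, h1]
  rw [← trace_sum, ← Matrix.mul_sum, ← Matrix.mul_sum, sum_specProj hS, mul_one]

omit [DecidableEq n] in
theorem re_trace_conjTranspose (A : Matrix n n ℂ) : (Aᴴ.trace).re = A.trace.re := by
  rw [trace_conjTranspose]; simp

/-- The initial marginal comes from trace preservation, the final one from the commutation
hypothesis, which lets the dephased state replace `ρ`. The factor `c` covers both `ΔS` and `ΔS / t`.
-/
theorem tmpExpectation_mul (L : Lindbladian n) (hS : S.IsHermitian) (ρ : Matrix n n ℂ) (t c : ℝ)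
    (hcomm : ∀ k : ℕ, Commute S ((dual L.gen ^ k) S)) :
    tmpExpectation L S ρ t (fun σ => c * σ)
      = c * ((bracket (L.evol t ρ) S).re - (bracket ρ S).re) := by
  set X : ℝ → Matrix n n ℂ := fun s => L.evol t (specProj S s * ρ * specProj S s) with hX
  have h1 : tmpExpectation L S ρ t (fun σ => c * σ)
      = ∑ p ∈ spec S ×ˢ spec S, c * (p.2 - p.1) * (bracket (X p.1) (specProj S p.2)).re := by
    rw [tmpExpectation, ← Finset.sum_fiberwise_of_maps_to
      (fun p hp => Finset.mem_image_of_mem (fun p : ℝ × ℝ => p.2 - p.1) hp)]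
    refine Finset.sum_congr rfl fun σ _ => ?_
    rw [tmpLaw, Finset.mul_sum]
    refine Finset.sum_congr rfl fun p hp => ?_
    rw [(Finset.mem_filter.mp hp).2]
  have hadd : ∀ (Y : Matrix n n ℂ) (g : ℝ → ℝ),
      ∑ s ∈ spec S, g s * (bracket Y (specProj S s)).re
        = (bracket Y (∑ s ∈ spec S, (g s : ℂ) • specProj S s)).re := fun Y g => by
    simp [bracket, Matrix.mul_sum, trace_sum]
  have h2 : ∀ s, ∑ s' ∈ spec S, c * (s' - s) * (bracket (X s) (specProj S s')).re
      = c * ((bracket (X s) S).re - s * (bracket (specProj S s * ρ * specProj S s) 1).re) := by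
    intro s
    have e1 := hadd (X s) fun s' => s'
    have e2 := hadd (X s) fun _ => 1
    rw [sum_smul_specProj hS] at e1
    simp only [Complex.ofReal_one, one_smul, sum_specProj hS, one_mul] at e2
    have e3 : (bracket (X s) 1).re = (bracket (specProj S s * ρ * specProj S s) 1).re := by
      simp only [bracket, mul_one, re_trace_conjTranspose, hX, Lindbladian.trace_evol]
    rw [← e3, ← e1, ← e2, mul_sub, Finset.mul_sum, Finset.mul_sum, Finset.mul_sum,
      ← Finset.sum_sub_distrib]
    refine Finset.sum_congr rfl fun s' _ => ?_
    ring
  have h3 : ∑ s ∈ spec S, (bracket (X s) S).re = (bracket (L.evol t ρ) S).re := by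
    have e1 : ∑ s ∈ spec S, (bracket (X s) S).re
        = (bracket (L.evol t (∑ s ∈ spec S, specProj S s * ρ * specProj S s)) S).re := by
      rw [Lindbladian.evol_map_sum]
      simp [bracket, conjTranspose_sum, Matrix.sum_mul, trace_sum, hX]
    -- The exponential series is tested term by term: each power of the adjoint sends `S` to a
    -- matrix commuting with `S`, which does not see dephasing.
    have e2 := L.bracket_evol_eq_zero
      (A := ∑ s ∈ spec S, specProj S s * ρ * specProj S s - ρ) (B := S) (fun k => by
        have := bracket_dephasing (A := ρ) hS (hcomm k)
        rw [bracket_pow_dual]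
        simp only [bracket] at this ⊢
        rw [conjTranspose_sub, sub_mul, trace_sub, this, sub_self]) t
    rw [Lindbladian.evol_map_sub] at e2
    simp only [bracket, conjTranspose_sub, sub_mul, trace_sub] at e2
    rw [e1]
    simp only [bracket]
    rw [sub_eq_zero.mp e2]
  have h4 : ∑ s ∈ spec S, s * (bracket (specProj S s * ρ * specProj S s) 1).re
      = (bracket ρ S).re := by
    have e : ∀ s, (bracket (specProj S s * ρ * specProj S s) 1).re
        = (bracket ρ (specProj S s)).re := fun s => by
      have hP : (specProj S s)ᴴ = specProj S s := by
        have : IsSelfAdjoint (specProj S s) := cfc_predicate _ _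
        exact this
      simp only [bracket, conjTranspose_mul, hP, mul_one]
      rw [trace_mul_comm, mul_assoc, specProj_mul_self]
    simp only [e]
    rw [hadd ρ fun s => s, sum_smul_specProj hS]
  rw [h1, Finset.sum_product]
  simp only [h2]
  rw [← Finset.mul_sum, Finset.sum_sub_distrib, h3, h4]

end SpectralProjections

/-! ### Relative entropy and entropy production -/

section RelativeEntropy

theorem isHermitian_entropyObs (ρ : Matrix n n ℂ) : (entropyObs ρ).IsHermitian := by
  have : IsSelfAdjoint (matLog ρ) := cfc_predicate _ _
  exact IsHermitian.neg this

theorem DetailedBalance.commute_entropyObs {ρ : Matrix n n ℂ} {L : Lindbladian n}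
    (h : DetailedBalance ρ L) (k : ℕ) :
    Commute (entropyObs ρ) ((dual L.gen ^ k) (entropyObs ρ)) := by
  have h0 : Commute ρ (entropyObs ρ) := ((Commute.refl ρ).cfc_real Real.log).symm.neg_right
  exact (Commute.cfc_real (h.commute_dual_gen_pow h0 k) Real.log).neg_left

theorem relEntropy_eq {μ ν : Matrix n n ℂ} (hν : ν.PosDef) :
    relEntropy μ ν = ((-vonNeumannEntropy μ + (bracket μ (entropyObs ν)).re : ℝ) : EReal) := by
  rw [relEntropy, if_pos]
  · congr 1
    simp [vonNeumannEntropy, entropyObs, bracket, sub_eq_add_neg, mul_add]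
  · intro v hv
    have : v = 0 := by
      by_contra h
      have := hν.dotProduct_mulVec_pos h
      simp [hv] at this
    simp [this]

open scoped Matrix.Norms.L2Operator in
theorem hasDerivAt_bracket_evol (L : Lindbladian n) (ρ B : Matrix n n ℂ) (t : ℝ) :
    HasDerivAt (fun s => (bracket (L.evol s ρ) B).re)
      (bracket (L.evol t ρ) (dual L.gen B)).re t := by
  let φ : Matrix n n ℂ →ₗ[ℝ] ℝ :=
    { toFun := fun A => (bracket A B).re
      map_add' := fun X Y => by simp [bracket, add_mul]
      map_smul' := fun r X => by simp [bracket] }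
  have := (φ.toContinuousLinearMap).hasFDerivAt.comp_hasDerivAt t (L.hasDerivAt_evol t ρ)
  refine this.congr_deriv ?_
  rw [← bracket_dual]
  rfl

theorem tendsto_epQuotient {L : Lindbladian n} {ν ρ : Matrix n n ℂ} (hν : ν.PosDef) {v : ℝ}
    (h : HasDerivWithinAt (fun t => vonNeumannEntropy (L.evol t ρ)) v (Set.Ioi 0) 0) :
    Tendsto (epQuotient L ν ρ) (𝓝[>] 0)
      (𝓝 ((v - (bracket ρ (fluxObs L ν)).re : ℝ) : EReal)) := by
  have h1 := (hasDerivAt_bracket_evol L ρ (entropyObs ν) 0).hasDerivWithinAt (s := Set.Ioi 0)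
  have h2 := (h.sub h1)
  rw [hasDerivWithinAt_iff_tendsto_slope' (by simp), L.evol_zero] at h2
  refine (EReal.tendsto_coe.mpr h2).congr' ?_
  refine eventually_nhdsWithin_of_forall fun t _ => ?_
  beta_reduce
  rw [epQuotient, relEntropy_eq hν, relEntropy_eq hν, ← EReal.coe_sub, ← EReal.coe_div,
    slope_def_field]
  congr 2
  · simp only [Pi.sub_apply, L.evol_zero]; ring
  · ring

theorem entropyProduction_eq {L : Lindbladian n} {ν ρ : Matrix n n ℂ} {v : ℝ}
    (h : Tendsto (epQuotient L ν ρ) (𝓝[>] 0) (𝓝 (v : EReal))) :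
    entropyProduction L ν ρ = v := h.limUnder_eq

end RelativeEntropy

/-! ### Integrated entropy balance -/

section IntegratedBalance

variable {L : Lindbladian n} {ν ρ : Matrix n n ℂ}

theorem integral_flux (L : Lindbladian n) (ν ρ : Matrix n n ℂ) (t : ℝ) :
    IntervalIntegrable (fun s => (bracket (L.evol s ρ) (fluxObs L ν)).re) volume 0 t ∧
    ∫ s in (0 : ℝ)..t, (bracket (L.evol s ρ) (fluxObs L ν)).re
      = (bracket (L.evol t ρ) (entropyObs ν)).re - (bracket ρ (entropyObs ν)).re := by
  have hc : Continuous fun s => (bracket (L.evol s ρ) (fluxObs L ν)).re :=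
    continuous_iff_continuousAt.mpr fun s =>
      (hasDerivAt_bracket_evol L ρ (fluxObs L ν) s).continuousAt
  refine ⟨hc.intervalIntegrable _ _, ?_⟩
  have h := intervalIntegral.integral_eq_sub_of_hasDerivAt
    (fun s _ => hasDerivAt_bracket_evol L ρ (entropyObs ν) s) (hc.intervalIntegrable 0 t)
  rwa [L.evol_zero] at h

theorem ae_hasDerivAt_entropy (hρ : IsState ρ) : ∃ w : ℝ → ℝ, ∀ t, 0 ≤ t →
    IntervalIntegrable w volume 0 t ∧
    ∫ s in (0 : ℝ)..t, w s = vonNeumannEntropy (L.evol t ρ) - vonNeumannEntropy ρ ∧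
    ∀ᵐ s : ℝ, s ∈ Set.Icc 0 t → HasDerivAt (fun t => vonNeumannEntropy (L.evol t ρ)) (w s) s := by
  obtain ⟨w, hw⟩ := Lindbladian.exists_integral_eq_entropy_sub (L := L) hρ
  refine ⟨w, fun t ht => ⟨(hw t ht).1, (hw t ht).2, ?_⟩⟩
  -- The time `0` is discarded as a null set: the integral formula is known only for nonnegative
  -- times, hence near `s` only when `s > 0`.
  filter_upwards [(hw t ht).1.ae_hasDerivAt_integral, measure_eq_zero_iff_ae_notMem.mp
    (measure_singleton (μ := (volume : Measure ℝ)) 0)] with s hs hs0 hst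
  rw [Set.uIcc_of_le ht] at hs
  have hs0 : 0 < s := lt_of_le_of_ne hst.1 (Ne.symm hs0)
  have h := (hs hst 0 ⟨le_rfl, ht⟩).add_const (vonNeumannEntropy ρ)
  refine h.congr_of_eventuallyEq ?_
  filter_upwards [Ioi_mem_nhds hs0] with x hx
  rw [(hw x (le_of_lt hx)).2]
  ring

theorem ae_tendsto_epQuotient (hν : ν.PosDef) (hρ : IsState ρ) : ∃ w : ℝ → ℝ, ∀ t, 0 ≤ t →
    IntervalIntegrable w volume 0 t ∧
    ∫ s in (0 : ℝ)..t, w s = vonNeumannEntropy (L.evol t ρ) - vonNeumannEntropy ρ ∧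
    ∀ᵐ s : ℝ, s ∈ Set.Icc 0 t → Tendsto (epQuotient L ν (L.evol s ρ)) (𝓝[>] 0)
      (𝓝 ((w s - (bracket (L.evol s ρ) (fluxObs L ν)).re : ℝ) : EReal)) := by
  obtain ⟨w, hw⟩ := ae_hasDerivAt_entropy (L := L) hρ
  refine ⟨w, fun t ht => ⟨(hw t ht).1, (hw t ht).2.1, (hw t ht).2.2.mono fun s hs hst => ?_⟩⟩
  refine tendsto_epQuotient hν (HasDerivAt.hasDerivWithinAt ?_)
  have h : HasDerivAt (fun t => vonNeumannEntropy (L.evol t ρ)) (w s) (s + 0) := by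
    rw [add_zero]; exact hs hst
  simpa only [L.evol_add] using h.comp_const_add s 0

theorem integral_entropyProduction (hν : ν.PosDef) (hρ : IsState ρ) {t : ℝ} (ht : 0 ≤ t) :
    (∀ᵐ s : ℝ, s ∈ Set.Icc 0 t → ∃ v : ℝ,
      Tendsto (epQuotient L ν (L.evol s ρ)) (𝓝[>] 0) (𝓝 (v : EReal))) ∧
    IntervalIntegrable (fun s => (entropyProduction L ν (L.evol s ρ)).toReal) volume 0 t ∧
    ∫ s in (0 : ℝ)..t, (bracket (L.evol s ρ) (fluxObs L ν)).re
      = vonNeumannEntropy (L.evol t ρ) - vonNeumannEntropy ρ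
        - ∫ s in (0 : ℝ)..t, (entropyProduction L ν (L.evol s ρ)).toReal := by
  obtain ⟨w, hw⟩ := ae_tendsto_epQuotient (L := L) hν hρ
  obtain ⟨hwi, hwint, hwae⟩ := hw t ht
  have hfi := (integral_flux L ν ρ t).1
  have hae : ∀ᵐ s : ℝ, s ∈ Set.uIoc 0 t → w s - (bracket (L.evol s ρ) (fluxObs L ν)).re
      = (entropyProduction L ν (L.evol s ρ)).toReal := by
    filter_upwards [hwae] with s hs hst
    rw [Set.uIoc_of_le ht] at hst
    rw [entropyProduction_eq (hs (Set.Ioc_subset_Icc_self hst)), EReal.toReal_coe]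
  refine ⟨hwae.mono fun s hs hst => ⟨_, hs hst⟩, ?_, ?_⟩
  · exact (hwi.sub hfi).congr_ae ((ae_restrict_iff' measurableSet_uIoc).mpr hae)
  · rw [← intervalIntegral.integral_congr_ae hae, intervalIntegral.integral_sub hwi hfi, hwint]
    ring

end IntegratedBalance

/-! ### Right derivative of the entropy at a singular state -/

theorem exists_abs_sub_le_sq {f f' : ℝ → ℝ} {c : ℝ} (hf : ∀ t, HasDerivAt f (f' t) t)
    (h0 : f' 0 = 0) (hf' : HasDerivAt f' c 0) :
    ∃ C, ∀ᶠ t in 𝓝[>] (0 : ℝ), |f t - f 0| ≤ C * t ^ 2 := by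
  obtain ⟨C, hC⟩ := hf'.isBigO_sub.bound
  obtain ⟨δ, hδ, hδ'⟩ := Metric.eventually_nhds_iff.mp hC
  refine ⟨C, eventually_of_mem (Ioo_mem_nhdsGT hδ) fun t ht => ?_⟩
  have hCt : ∀ x ∈ Set.Ico 0 t, ‖f' x‖ ≤ C * t := by
    intro x hx
    have h1 := hδ' (y := x) (by
      rw [Real.dist_eq, sub_zero, abs_of_nonneg hx.1]; exact hx.2.trans ht.2)
    have h2 := hδ' (y := t) (by
      rw [Real.dist_eq, sub_zero, abs_of_pos ht.1]; exact ht.2)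
    simp only [h0, sub_zero] at h1 h2
    have hC0 : 0 ≤ C := by
      by_contra h
      have : C * ‖t‖ < 0 := mul_neg_of_neg_of_pos (not_le.mp h) (norm_pos_iff.mpr ht.1.ne')
      linarith [norm_nonneg (f' t)]
    refine h1.trans (mul_le_mul_of_nonneg_left ?_ hC0)
    rw [Real.norm_of_nonneg hx.1]
    exact hx.2.le
  have := norm_image_sub_le_of_norm_deriv_le_segment' (f := f) (a := 0) (b := t)
    (fun x _ => (hf x).hasDerivWithinAt) hCt t ⟨ht.1.le, le_rfl⟩
  rw [Real.norm_eq_abs] at this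
  linarith

theorem tendsto_mul_log_sq_div {m : ℝ → ℝ} {C : ℝ} (hm : ∀ᶠ t in 𝓝[>] (0 : ℝ), |m t| ≤ C * t ^ 2) :
    Tendsto (fun t => (t ^ 2 - m t * Real.log (t ^ 2)) / t) (𝓝[>] 0) (𝓝 0) := by
  have h1 : Tendsto (fun t : ℝ => C * (2 * |t * Real.log t|)) (𝓝[>] 0) (𝓝 0) := by
    have : Continuous fun t : ℝ => C * (2 * |t * Real.log t|) :=
      ((Real.continuous_mul_log.abs).const_mul 2).const_mul C
    simpa using (this.tendsto 0).mono_left (nhdsWithin_le_nhds (s := Set.Ioi 0))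
  have h2 : Tendsto (fun t : ℝ => m t * Real.log (t ^ 2) / t) (𝓝[>] 0) (𝓝 0) := by
    refine squeeze_zero_norm' ?_ h1
    filter_upwards [hm, self_mem_nhdsWithin] with t ht (h0 : 0 < t)
    rw [norm_div, norm_mul, Real.norm_of_nonneg h0.le, div_le_iff₀ h0, Real.log_pow, abs_mul,
      abs_of_pos h0, norm_mul]
    calc _ ≤ C * t ^ 2 * (‖((2 : ℕ) : ℝ)‖ * ‖Real.log t‖) := by
          gcongr
          exact ht
      _ = _ := by rw [Real.norm_eq_abs (Real.log t)]; norm_num; ring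
  have h3 : Tendsto (fun t : ℝ => t) (𝓝[>] 0) (𝓝 0) :=
    tendsto_id.mono_left nhdsWithin_le_nhds
  have h4 := h3.sub h2
  rw [sub_zero] at h4
  refine h4.congr' ?_
  filter_upwards [self_mem_nhdsWithin] with t (h0 : 0 < t)
  field_simp

section Boundary

variable {L : Lindbladian n} {ρ : Matrix n n ℂ}

open scoped Matrix.Norms.L2Operator in
theorem hasDerivAt_eigenDiag {A : Matrix n n ℂ} (hA : A.IsHermitian) (T : Matrix n n ℂ →ₗ[ℂ] Matrix n n ℂ)
    (L : Lindbladian n) (ρ : Matrix n n ℂ) (i : n) (t : ℝ) :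
    HasDerivAt (fun s => eigenDiag hA (T (L.evol s ρ)) i)
      (eigenDiag hA (T (L.gen (L.evol t ρ))) i) t := by
  let φ : Matrix n n ℂ →ₗ[ℝ] ℝ :=
    { toFun := fun M => eigenDiag hA (T M) i
      map_add' := fun X Y => by simp [eigenDiag, mul_add, add_mul]
      map_smul' := fun r X => by
        have : r • X = (r : ℂ) • X := by ext; simp
        rw [this]
        simp [eigenDiag] }
  exact (φ.toContinuousLinearMap).hasFDerivAt.comp_hasDerivAt t (L.hasDerivAt_evol t ρ)

theorem sum_eigenDiag {A : Matrix n n ℂ} (hA : A.IsHermitian) (M : Matrix n n ℂ) :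
    ∑ i, eigenDiag hA M i = M.trace.re := by
  have h := re_trace_mul_cfc hA M fun _ => 1
  rw [cfc_const_one ℝ A (show IsSelfAdjoint A from hA)] at h
  simpa using h.symm

theorem eigenDiag_self {A : Matrix n n ℂ} (hA : A.IsHermitian) (i : n) :
    eigenDiag hA A i = hA.eigenvalues i := by
  have hspec := cfc_eq_conj hA (fun x => x)
  rw [cfc_id' ℝ A (show IsSelfAdjoint A from hA)] at hspec
  have hUU : (hA.eigenvectorUnitary : Matrix n n ℂ)ᴴ * (hA.eigenvectorUnitary : Matrix n n ℂ) = 1 :=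
    Unitary.coe_star_mul_self hA.eigenvectorUnitary
  have : (hA.eigenvectorUnitary : Matrix n n ℂ)ᴴ * A * (hA.eigenvectorUnitary : Matrix n n ℂ)
      = diagonal (fun i => (hA.eigenvalues i : ℂ)) := by
    conv_lhs => enter [1, 2]; rw [hspec]
    rw [← mul_assoc, ← mul_assoc, hUU, one_mul, mul_assoc, hUU, mul_one]
  rw [eigenDiag, this]
  simp

/-- Klein's inequality against `ρ` with its zero eigenvalues replaced by `η`, which keeps the
logarithm finite; the linear terms cancel because both traces are one. -/
theorem entropy_sub_le {ρ σ : Matrix n n ℂ} (hρ : IsState ρ) (hσ : IsState σ) {η : ℝ} (hη : 0 < η) :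
    vonNeumannEntropy σ - vonNeumannEntropy ρ ≤ ∑ i, if hρ.1.1.eigenvalues i = 0
      then η - eigenDiag hρ.1.1 σ i * Real.log η
      else -((eigenDiag hρ.1.1 σ i - hρ.1.1.eigenvalues i) * Real.log (hρ.1.1.eigenvalues i)) := by
  set p := hρ.1.1.eigenvalues with hp
  set m := eigenDiag hρ.1.1 σ with hm
  set β : ℝ → ℝ := fun y => if y = 0 then η else y with hβ
  have h1 := re_trace_cfc_le hσ.1.1 hρ.1.1 (f := Real.negMulLog) (φ := β)
    (d := fun y => -1 - Real.log (β y)) fun i j => by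
      have hb : 0 < β (p j) := by
        simp only [hβ]
        split_ifs with h
        · exact hη
        · exact lt_of_le_of_ne (hρ.1.eigenvalues_nonneg j) (Ne.symm h)
      have := negMulLog_le_sub_sub (hσ.1.eigenvalues_nonneg i) hb
      linarith
  rw [← vonNeumannEntropy_eq hσ.1.1, re_trace_cfc hρ.1.1, re_trace_mul_cfc hρ.1.1] at h1
  have h2 : ∑ i, m i = ∑ i, p i := by
    rw [hm, sum_eigenDiag, hσ.2, ← hρ.2, ← sum_eigenDiag hρ.1.1]
    simp only [eigenDiag_self, hp]
  rw [vonNeumannEntropy_eq hρ.1.1, re_trace_cfc hρ.1.1]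
  have h3 : ∑ i, β (p i) + ∑ i, m i * (-1 - Real.log (β (p i))) - ∑ i, Real.negMulLog (p i)
      = ∑ i, (if p i = 0 then η - m i * Real.log η else -((m i - p i) * Real.log (p i)))
        + (∑ i, p i - ∑ i, m i) := by
    rw [← Finset.sum_add_distrib, ← Finset.sum_sub_distrib, ← Finset.sum_sub_distrib,
      ← Finset.sum_add_distrib]
    refine Finset.sum_congr rfl fun i _ => ?_
    simp only [hβ, Real.negMulLog]
    split_ifs with h
    · rw [h]; ring
    · ring
  rw [h2, sub_self, add_zero] at h3
  linarith

/-- The hypothesis makes the populations of `ker ρ` grow only quadratically in time, so they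
contribute nothing to the derivative despite the infinite slope of `-x log x` at zero. -/
theorem hasDerivWithinAt_entropy_zero (hρ : IsState ρ)
    (hker : ∀ i, hρ.1.1.eigenvalues i = 0 → eigenDiag hρ.1.1 (L.gen ρ) i = 0) :
    HasDerivWithinAt (fun t => vonNeumannEntropy (L.evol t ρ))
      (-(L.gen ρ * matLog ρ).trace.re) (Set.Ioi 0) 0 := by
  set p := hρ.1.1.eigenvalues with hp
  set l := eigenDiag hρ.1.1 (L.gen ρ) with hl
  have hv : -(L.gen ρ * matLog ρ).trace.re = ∑ i, -(l i * Real.log (p i)) := by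
    rw [matLog, re_trace_mul_cfc hρ.1.1, Finset.sum_neg_distrib]
  rw [hasDerivWithinAt_iff_tendsto_slope' (by simp), hv]
  have hslope : ∀ t, slope (fun t => vonNeumannEntropy (L.evol t ρ)) 0 t
      = (vonNeumannEntropy (L.evol t ρ) - vonNeumannEntropy ρ) / t := fun t => by
    rw [slope_def_field, L.evol_zero, sub_zero]
  have hd : ∀ i t, HasDerivAt (fun s => eigenDiag hρ.1.1 (L.evol s ρ) i)
      (eigenDiag hρ.1.1 (L.gen (L.evol t ρ)) i) t := fun i t =>
    hasDerivAt_eigenDiag hρ.1.1 LinearMap.id L ρ i t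
  have hm0 : ∀ i, eigenDiag hρ.1.1 (L.evol 0 ρ) i = p i := fun i => by
    rw [L.evol_zero, eigenDiag_self]
  have hl0 : ∀ i, eigenDiag hρ.1.1 (L.gen (L.evol 0 ρ)) i = l i := fun i => by
    rw [L.evol_zero]
  -- Upper bound with `η = t ^ 2`: on the kernel, both `η / t` and `O(t ^ 2) log η / t` vanish in
  -- the limit.
  have hupper : Tendsto (fun t => ∑ i, (if p i = 0
      then t ^ 2 - eigenDiag hρ.1.1 (L.evol t ρ) i * Real.log (t ^ 2)
      else -((eigenDiag hρ.1.1 (L.evol t ρ) i - p i) * Real.log (p i))) / t) (𝓝[>] 0)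
      (𝓝 (∑ i, -(l i * Real.log (p i)))) := by
    refine tendsto_finsetSum _ fun i _ => ?_
    by_cases h : p i = 0
    · simp only [h, if_true, Real.log_zero, mul_zero, neg_zero]
      obtain ⟨C, hC⟩ := exists_abs_sub_le_sq (hd i) (by rw [hl0]; exact hker i h)
        (hasDerivAt_eigenDiag hρ.1.1 L.gen L ρ i 0)
      simp only [hm0, h, sub_zero] at hC
      exact tendsto_mul_log_sq_div hC
    · simp only [if_neg h]
      have h1 := ((hd i 0).hasDerivWithinAt (s := Set.Ioi 0))
      rw [hasDerivWithinAt_iff_tendsto_slope' (by simp), hl0] at h1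
      refine (h1.mul_const (Real.log (p i))).neg.congr fun t => ?_
      rw [slope_def_field, hm0, sub_zero]
      ring
  refine tendsto_order.mpr ⟨fun c hc => ?_, fun c hc => ?_⟩
  -- Lower bound: for fixed `δ` the regularized entropy is differentiable at zero, and its corrected
  -- rate tends to the claimed value as `δ` decreases, because kernel terms vanish and `L ρ` has
  -- zero trace.
  · obtain ⟨C, hC⟩ := L.exists_entropy_sub_ge
    have hrate : Tendsto (fun δ => regEntropyRate δ (L.gen ρ) ρ - C * δ) (𝓝[>] 0)
        (𝓝 (∑ i, -(l i * Real.log (p i)))) := by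
      have hsum : ∑ i, -(l i * Real.log (p i)) = ∑ i, l i * (-Real.log (p i) - 1) - C * 0 := by
        have : ∑ i, l i = 0 := by rw [hl, sum_eigenDiag, L.trace_gen]; simp
        simp only [mul_sub, mul_neg, mul_one, Finset.sum_sub_distrib, this, mul_zero, sub_zero]
      rw [hsum]
      refine Tendsto.sub ?_ ((tendsto_id.mono_left nhdsWithin_le_nhds).const_mul C)
      simp only [regEntropyRate, re_trace_mul_cfc hρ.1.1]
      refine tendsto_finsetSum _ fun i _ => ?_
      by_cases h : p i = 0
      · have : eigenDiag hρ.1.1 (L.gen ρ) i = 0 := hker i h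
        simp only [hl, this, zero_mul]
        exact tendsto_const_nhds
      · have hlog : Tendsto (fun δ => Real.log (p i + δ)) (𝓝[>] 0) (𝓝 (Real.log (p i))) := by
          have h1 : ContinuousAt (fun δ => Real.log (p i + δ)) 0 :=
            ContinuousAt.log (by fun_prop) (by simpa using h)
          have h2 := h1.tendsto
          rw [add_zero] at h2
          exact h2.mono_left nhdsWithin_le_nhds
        exact (hlog.neg.sub_const 1).const_mul _
    obtain ⟨δ, hδ1, hδ0⟩ := ((hrate.eventually_const_lt hc).and self_mem_nhdsWithin).exists
    have hδ0 : 0 < δ := hδ0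
    have h1 := (Lindbladian.hasDerivWithinAt_regEntropy_evol (L := L) hρ hδ0 le_rfl).mono
      Set.Ioi_subset_Ici_self
    rw [hasDerivWithinAt_iff_tendsto_slope' (by simp), L.evol_zero] at h1
    have h2 := h1.sub_const (C * δ)
    filter_upwards [h2.eventually_const_lt hδ1, self_mem_nhdsWithin] with t ht (h0 : 0 < t)
    refine ht.trans_le ?_
    rw [hslope, slope_def_field, L.evol_zero, sub_zero, le_div_iff₀ h0, sub_mul,
      div_mul_cancel₀ _ h0.ne']
    exact hC ρ hρ δ t hδ0 h0.le
  · filter_upwards [hupper.eventually_lt_const hc, self_mem_nhdsWithin] with t ht (h0 : 0 < t)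
    refine lt_of_le_of_lt ?_ ht
    rw [hslope, ← Finset.sum_div]
    exact div_le_div_of_nonneg_right
      (entropy_sub_le hρ (L.isState_evol hρ h0.le) (by positivity)) h0.le

/-- At eigenvalue zero the bound `-C p` makes every reservoir's contribution nonnegative, while
stationarity of the total makes their sum zero. -/
theorem eigenDiag_gen_eq_zero {J : Type*} [Fintype J] {Ls : J → Lindbladian n}
    (hL : L.gen = ∑ j, (Ls j).gen) (hρ : IsState ρ) (h0 : L.gen ρ = 0) (j : J) (i : n)
    (hi : hρ.1.1.eigenvalues i = 0) : eigenDiag hρ.1.1 ((Ls j).gen ρ) i = 0 := by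
  have hnn : ∀ j ∈ Finset.univ, 0 ≤ eigenDiag hρ.1.1 ((Ls j).gen ρ) i := fun j _ => by
    obtain ⟨C, -, hC⟩ := (Ls j).exists_le_eigenDiag_gen
    simpa [hi] using hC ρ hρ.1 i
  have hsum : ∑ j, eigenDiag hρ.1.1 ((Ls j).gen ρ) i = 0 := by
    rw [← eigenDiag_sum, ← LinearMap.sum_apply, ← hL, h0]
    simp [eigenDiag]
  exact (Finset.sum_eq_zero_iff_of_nonneg hnn).mp hsum j (Finset.mem_univ j)

theorem tendsto_tmpExpectation_div {ν : Matrix n n ℂ} (h : DetailedBalance ν L)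
    (ρ : Matrix n n ℂ) :
    Tendsto (fun t : ℝ => tmpExpectation L (entropyObs ν) ρ t fun σ => σ / t) (𝓝[>] 0)
      (𝓝 (bracket ρ (fluxObs L ν)).re) := by
  have h1 := (hasDerivAt_bracket_evol L ρ (entropyObs ν) 0).hasDerivWithinAt (s := Set.Ioi 0)
  rw [hasDerivWithinAt_iff_tendsto_slope' (by simp), L.evol_zero] at h1
  refine h1.congr fun t => ?_
  have := tmpExpectation_mul L (isHermitian_entropyObs ν) ρ t t⁻¹ h.commute_entropyObs
  simp only [div_eq_inv_mul]
  rw [this, slope_def_field, L.evol_zero, sub_zero, div_eq_inv_mul]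

end Boundary
end MQD

open MQD
theorem mainTheorem1 {n J : Type*} [Fintype n] [DecidableEq n] [Fintype J]
    (L : Lindbladian n) (Ls : J → Lindbladian n) (ρs : J → Matrix n n ℂ)
    (hRS : ReservoirStructure L Ls ρs)
    (hDB : ∀ j, DetailedBalance (ρs j) (Ls j)) :
    (∀ (j : J) (ρ₀ : Matrix n n ℂ), IsState ρ₀ → ∀ t : ℝ, 0 ≤ t →
      tmpExpectation (Ls j) (entropyObs (ρs j)) ρ₀ t (fun σ => σ)
          = ∫ s in (0 : ℝ)..t, (bracket ((Ls j).evol s ρ₀) (fluxObs (Ls j) (ρs j))).re ∧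
      (∀ᵐ s : ℝ, s ∈ Set.Icc 0 t → ∃ v : ℝ,
        Tendsto (epQuotient (Ls j) (ρs j) ((Ls j).evol s ρ₀)) (𝓝[>] 0) (𝓝 (v : EReal))) ∧
      IntervalIntegrable
        (fun s => (entropyProduction (Ls j) (ρs j) ((Ls j).evol s ρ₀)).toReal) volume 0 t ∧
      ∫ s in (0 : ℝ)..t, (bracket ((Ls j).evol s ρ₀) (fluxObs (Ls j) (ρs j))).re
          = vonNeumannEntropy ((Ls j).evol t ρ₀) - vonNeumannEntropy ρ₀
            - ∫ s in (0 : ℝ)..t,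
                (entropyProduction (Ls j) (ρs j) ((Ls j).evol s ρ₀)).toReal) ∧
    (∀ ρ : Matrix n n ℂ, L.IsSteadyState ρ →
      (∀ j, ∃ v : ℝ, Tendsto (epQuotient (Ls j) (ρs j) ρ) (𝓝[>] 0) (𝓝 (v : EReal))) ∧
      ∃ e : ℝ, totalEntropyProduction Ls ρs ρ = (e : EReal) ∧
        Tendsto (fun t : ℝ =>
            ∑ j, tmpExpectation (Ls j) (entropyObs (ρs j)) ρ t (fun σ => σ / t))
          (𝓝[>] 0) (𝓝 (-e))) := by
  refine ⟨fun j ρ₀ hρ₀ t ht => ⟨?_, integral_entropyProduction (hDB j).2.1 hρ₀ ht⟩,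
    fun ρ hρ => ?_⟩
  · have h := tmpExpectation_mul (Ls j) (isHermitian_entropyObs (ρs j)) ρ₀ t 1
      (hDB j).commute_entropyObs
    simp only [one_mul] at h
    rw [h, (integral_flux (Ls j) (ρs j) ρ₀ t).2]
  · have hep := fun j => tendsto_epQuotient (hDB j).2.1
      (hasDerivWithinAt_entropy_zero (L := Ls j) hρ.1 (eigenDiag_gen_eq_zero hRS.1 hρ.1 hρ.2 j))
    refine ⟨fun j => ⟨_, hep j⟩, -∑ j, (bracket ρ (fluxObs (Ls j) (ρs j))).re, ?_, ?_⟩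
    · have hcoe : ∀ f : J → ℝ, ∑ j, ((f j : ℝ) : EReal) = ((∑ j, f j : ℝ) : EReal) := fun f =>
        (map_sum (⟨⟨Real.toEReal, EReal.coe_zero⟩, EReal.coe_add⟩ : ℝ →+ EReal) f _).symm
      simp only [totalEntropyProduction, fun j => entropyProduction_eq (hep j), hcoe]
      congr 1
      -- The individual entropy rates need not vanish; only their sum does, by stationarity for the
      -- total generator.
      have hz : ∑ j, ((Ls j).gen ρ * matLog ρ).trace.re = 0 := by
        rw [← Complex.re_sum, ← trace_sum, ← Matrix.sum_mul, ← LinearMap.sum_apply, ← hRS.1, hρ.2]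
        simp
      rw [Finset.sum_sub_distrib, Finset.sum_neg_distrib, hz]
      ring
    · rw [neg_neg]
      exact tendsto_finsetSum _ fun j _ => tendsto_tmpExpectation_div (hDB j) ρ
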